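/- **Theorem 4.1.** Let $\Omega\subset\mathbb R^2$ be a bounded domain (nonempty, open, connected) with Lipschitz continuous boundary. Let $H$ and $V$ be the closures of the space of smooth divergence-free vector fields with compact support in $\Omega$ in $L^2(\Omega)^2$ and in $H^1(\Omega)^2$. Write $|\cdot|$ for the $L^2$-norm, $((u,v))=(\nabla u,\nabla v)_{L^2}$, $\|v\|_V=((v,v))^{1/2}$, $\|v\|_{H^1}^2=|\Omega|^{-1/2}|v|^2+\|v\|_V^2$, $b(u,v,w)=\int_\Omega ((u\cdot\nabla)v)\cdot w\,dx$, and let $V'$ be the dual of $V$ with $\|\ell\|_{V'}=\sup\{|\langle \ell,v\rangle| : v\in V,\ \|v\|_V\le 1\}$. For $\nu>0$, a forcing $f$ that belongs to $L^2([0,T];V')$ for every $T>0$, and $u_0\in H$, a *weak solution* (on $[0,\infty)$) of the Navier–Stokes equations with viscosity $\nu$, forcing $f$ and initial value $u_0$ is a function $u$ such that, for every $T>0$, $u\in L^2([0,T];V)\cap L^\infty([0,T];H)$, which is weakly continuous with values in $H$ on $[0,\infty)$, whose distributional derivative $du/dt$ lies in $L^1_{\rm loc}((0,\infty);V')$, with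 $u(0)=u_0$ and, for almost every $t>0$, $$\Big\langle \frac{du}{dt}(t),v\Big\rangle+\nu((u(t),v))+b(u(t),u(t),v)=\langle f(t),v\rangle\qquad\text{for all } v\in V .$$ Let $C_1>0$ and $\gamma>0$. Then there is a constant $C>0$, depending only on $\Omega$, $C_1$ and $\gamma$ (in particular independent of $\nu$ and $f$), such that the following holds for every $\nu>0$. Let $f,g$ be forcings as above with $$\lim_{t\to\infty}\|f(t)-g(t)\|_{V'}=0,$$ and let $u,v$ be weak solutions with viscosity $\nu$, forcings $f$, $g$ respectively, and arbitrary initial values $u_0,v_0\in H$. Let $V_N\subset L^2(\Omega)^2$ be a linear subspace of finite dimension $N$ and let $R_N:V\to V_N$ be a linear map with $$\lim_{t\to\infty}\|R_N(u(t)-v(t))\|_{L^2(\Omega)}=0,\qquad \|w-R_Nw\|_{L^2(\Omega)}\le C_1N^{-\gamma}\|w\|_{H^1(\Omega)}\quad\text{for all } w\in V .$$ If $$N> C\left(\frac1{\nu^2}\limsup_{t\to\infty}\|f(t)\|_{V'}\right)^{1/\gamma}$$ (so that in particular the upper limit is finite), then $$\lim_{t\to\infty}|u(t)-v(t)|=0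 .$$ Here $f(t),g(t)$, and $u(t),v(t)$ as elements of $V$, are given for almost every $t$ only, and the limits and the upper limit in the hypotheses are taken over almost every $t$ (ignoring a null set of times); the limit in the conclusion is over all $t$. -/

import Mathlib

open MeasureTheory Filter Topology Set
open scoped ENNReal NNReal ContDiff

noncomputable section

namespace NavierStokes

/-- The Euclidean plane. -/
abbrev Plane : Type := EuclideanSpace ℝ (Fin 2)

/-- `Ω` has a Lipschitz continuous boundary: near each boundary point, in suitable Cartesian
coordinates, `Ω` is the part of a neighbourhood lying strictly above the graph of a Lipschitz
function. -/
def HasLipschitzBoundary (Ω : Set Plane) : Prop :=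
  ∀ x ∈ frontier Ω, ∃ (e : Plane ≃ᵃⁱ[ℝ] Plane) (K : ℝ≥0) (φ : ℝ → ℝ) (U : Set Plane),
    LipschitzWith K φ ∧ U ∈ 𝓝 x ∧ ∀ y ∈ U, (y ∈ Ω ↔ φ ((e y) 0) < (e y) 1)

/-- The classical partial derivative `∂φ/∂xⱼ`. -/
def pderiv (j : Fin 2) (φ : Plane → Plane) (x : Plane) : Plane :=
  fderiv ℝ φ x (EuclideanSpace.single j 1)

/-- The smooth divergence-free vector fields with compact support in `Ω`. -/
structure IsTestField (Ω : Set Plane) (φ : Plane → Plane) : Prop where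
  smooth : ContDiff ℝ ∞ φ
  compactSupport : HasCompactSupport φ
  support_subset : tsupport φ ⊆ Ω
  divFree : ∀ x, ∑ j : Fin 2, (pderiv j φ x) j = 0

/-- The space `L²(Ω)²` of square integrable vector fields. -/
abbrev L2 (Ω : Set Plane) : Type := Lp Plane 2 (volume.restrict Ω)

/-- The Hilbert space `L²(Ω)² × L²(Ω)² × L²(Ω)²`.  A vector field `u` of class `H¹(Ω)` is
represented in it by the triple `(u, ∂₀u, ∂₁u)`; this identifies `H¹(Ω)²` isometrically (for the
usual norm) with a closed subspace. -/
abbrev Jet (Ω : Set Plane) : Type := PiLp 2 (fun _ : Fin 3 => L2 Ω)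

/-- `H`: the closure in `L²(Ω)²` of the space of test fields (the test fields already form a
linear space, so that taking their span adds nothing). -/
def H (Ω : Set Plane) : Submodule ℝ (L2 Ω) :=
  (Submodule.span ℝ {u : L2 Ω | ∃ φ : Plane → Plane, IsTestField Ω φ ∧
    u =ᵐ[volume.restrict Ω] φ}).topologicalClosure

/-- `V` as a closed subspace of `Jet Ω`: the closure in `H¹(Ω)²` of the space of test fields, each `u` being represented by
`(u, ∂₀u, ∂₁u)`. -/
def VSubmodule (Ω : Set Plane) : Submodule ℝ (Jet Ω) :=
  (Submodule.span ℝ {w : Jet Ω | ∃ φ : Plane → Plane, IsTestField Ω φ ∧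
    w 0 =ᵐ[volume.restrict Ω] φ ∧
    ∀ j : Fin 2, w j.succ =ᵐ[volume.restrict Ω] pderiv j φ}).topologicalClosure

/-- The space `V`, a Hilbert space for the inner product of `H¹(Ω)²`. -/
def V (Ω : Set Plane) : Type := VSubmodule Ω

instance (Ω : Set Plane) : NormedAddCommGroup (V Ω) :=
  inferInstanceAs (NormedAddCommGroup (VSubmodule Ω))

instance (Ω : Set Plane) : InnerProductSpace ℝ (V Ω) :=
  inferInstanceAs (InnerProductSpace ℝ (VSubmodule Ω))

variable {Ω : Set Plane}

/-- An element of `V`, as the triple `(u, ∂₀u, ∂₁u)`. -/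
def V.toJet (v : V Ω) : Jet Ω := Subtype.val (p := fun w => w ∈ VSubmodule Ω) v

/-- An element of `V`, as a vector field of class `L²`. -/
def V.field (v : V Ω) : L2 Ω := V.toJet v 0

/-- The weak partial derivative `∂ⱼv` of an element of `V`. -/
def V.partialDeriv (j : Fin 2) (v : V Ω) : L2 Ω := V.toJet v j.succ

/-- The Dirichlet form `((u, v)) = (∇u, ∇v)`, the inner product of `V`. -/
def dirichlet (u v : V Ω) : ℝ :=
  ∑ j : Fin 2, inner ℝ (V.partialDeriv j u) (V.partialDeriv j v)

/-- The norm `‖v‖_V = ((v, v))^{1/2} = ‖∇v‖_{L²(Ω)}` of `V`. -/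
def normV (v : V Ω) : ℝ := Real.sqrt (dirichlet v v)

/-- The norm of `H¹(Ω)` in two dimensions, normalized by the area of `Ω`:
`‖v‖²_{H¹} = |Ω|^{-1/2} ‖v‖²_{L²} + ‖∇v‖²_{L²}`. -/
def normH1 (v : V Ω) : ℝ :=
  Real.sqrt (volume.real Ω ^ (-(1 / 2) : ℝ) * ‖V.field v‖ ^ 2 + dirichlet v v)

/-- The trilinear form `b(u, v, w) = ∫_Ω ((u · ∇) v) · w dx`. -/
def trilinear (u v w : V Ω) : ℝ :=
  ∫ x in Ω, ∑ j : Fin 2,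
    (V.field u x) j * inner ℝ (V.partialDeriv j v x) (V.field w x)

/-- `V'`: the bounded linear functionals on `V`.  (By the Poincaré inequality the norm of `H¹(Ω)`
and the norm `normV` have the same bounded functionals.) -/
abbrev VDual (Ω : Set Plane) : Type := StrongDual ℝ (V Ω)

/-- The norm `‖ℓ‖_{V'} = sup {|⟨ℓ, v⟩| : ‖v‖_V ≤ 1}`, dual to `normV`. -/
def normVDual (l : VDual Ω) : ℝ≥0∞ := ⨆ (v : V Ω) (_ : normV v ≤ 1), ‖l v‖ₑ

/-- `f ∈ L²([0,T]; V')` for every `T > 0`. -/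
def IsForcing (f : ℝ → VDual Ω) : Prop :=
  ∀ T > 0, MemLp f 2 (volume.restrict (Icc 0 T))

/-- A weak solution on `[0, ∞)` of the two-dimensional Navier-Stokes equations with viscosity `ν`,
forcing `f` and initial value `u₀`.  Only the values at times `t ≥ 0` are relevant.
* `toH t` is the velocity `u(t)`, an element of `H` for each time;
* `toV t` is the same velocity, as an element of `V`, for almost each time;
* `dt` is the time derivative `du/dt`, a function with values in `V'`. -/
structure WeakSolution (Ω : Set Plane) (ν : ℝ) (f : ℝ → VDual Ω) (u₀ : H Ω) where
  toH : ℝ → H Ω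
  toV : ℝ → V Ω
  dt : ℝ → VDual Ω
  /-- `toH` and `toV` are the same function. -/
  toV_eq : ∀ᵐ t ∂(volume.restrict (Ioi (0 : ℝ))), V.field (toV t) = (toH t : L2 Ω)
  /-- `u ∈ L²([0,T]; V)`. -/
  memL2 : ∀ T > 0, MemLp toV 2 (volume.restrict (Icc 0 T))
  /-- `u ∈ L^∞([0,T]; H)`. -/
  memLinfty : ∀ T > 0, MemLp toH ∞ (volume.restrict (Icc 0 T))
  /-- `u` is weakly continuous with values in `H`. -/
  weaklyContinuous : ∀ h : H Ω, ContinuousOn (fun t => (inner ℝ (toH t) h : ℝ)) (Ici 0)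
  /-- `du/dt` is locally integrable on `(0, T]` with values in `V'`. -/
  dt_locallyIntegrable : LocallyIntegrableOn dt (Ioi 0)
  /-- `dt` is the derivative of `u` in the sense of distributions with values in `V'`. -/
  dt_isDeriv : ∀ (v : V Ω) (ψ : ℝ → ℝ), ContDiff ℝ ∞ ψ → HasCompactSupport ψ →
    tsupport ψ ⊆ Ioi 0 →
    ∫ t, deriv ψ t * (inner ℝ (toH t : L2 Ω) (V.field v) : ℝ) = -∫ t, ψ t * dt t v
  /-- The equation holds for almost every time. -/
  equation : ∀ᵐ t ∂(volume.restrict (Ioi (0 : ℝ))), ∀ v : V Ω,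
    dt t v + ν * dirichlet (toV t) v + trilinear (toV t) (toV t) v = f t v
  /-- The initial condition. -/
  initial : toH 0 = u₀

/-- The filter of almost all times tending to infinity. Limits and upper limits along it are
limits and upper limits for `t → ∞` of functions of time that are given only up to a null set. -/
def aeTop : Filter ℝ := atTop ⊓ ae volume

end NavierStokes

end

open NavierStokes

/-! Put `w = u - v`. Subtract the two equations and test with `w`: since `b(v, w, w) = 0`, the
convection terms collapse to `b(w, u, w)`, which in the plane is at most `c |w| ‖w‖ ‖u‖`
(`abs_trilinear_self_le`, from Ladyzhenskaya's inequality). The hypotheses on `R_N` say `|w| ≤ k ‖w‖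
+ o(1)` with `k` proportional to `N ^ (-γ)`, so the viscous term damps `|w|²` at a rate of order `ν
/ k²`. Young's inequality then gives `d/dt |w|² + α |w|² ≤ o(1)` with `α = ν / (2k²) - (2c²/ν) ‖u‖²`
(`two_mul_inner_riesz_dt_sub_le`).

The coefficient `α` may be negative at single times, but the energy balance of `u` bounds the
long-time mean of `‖u‖²` by `F² / ν²`, for any `F` above the upper limit of the norms of `f`
(`exists_integral_normV_sq_le`). Hence `α` is positive in the mean once `2ckF < ν²`, which is what
the lower bound on `N` provides, and `gronwall_of_mean` forces `|w|` to decay.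

Two points of rigour remain. The formula `d/dt |w|² = 2 ⟨w', w⟩` is proved for almost all pairs of
times from the continuity of translations in `L²` (`exists_energy_equality`). The decay, obtained
for almost every time, is extended to every time by weak continuity (`norm_le_of_ae_norm_le`). -/

noncomputable section

namespace NavierStokes

/-! ### The space `V`: its norms and the density of test fields. -/

variable {Ω : Set Plane}

instance : CompleteSpace (V Ω) :=
  inferInstanceAs (CompleteSpace (Submodule.topologicalClosure _ : Submodule ℝ (Jet Ω)))

/-- The representation of `V` by triples, as a continuous linear map. -/
def V.toJetL : V Ω →L[ℝ] Jet Ω := (VSubmodule Ω).subtypeL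

/-- `V.field` as a continuous linear map. -/
def V.fieldL : V Ω →L[ℝ] L2 Ω := (PiLp.proj 2 (fun _ : Fin 3 => L2 Ω) 0).comp V.toJetL

/-- `V.partialDeriv` as a continuous linear map. -/
def V.partialL (j : Fin 2) : V Ω →L[ℝ] L2 Ω :=
  (PiLp.proj 2 (fun _ : Fin 3 => L2 Ω) j.succ).comp V.toJetL

lemma V.fieldL_apply (v : V Ω) : V.fieldL v = V.field v := rfl

lemma V.norm_sq (v : V Ω) : ‖v‖ ^ 2 = ‖V.field v‖ ^ 2 + dirichlet v v := by
  have h : ‖v‖ = ‖V.toJet v‖ := rfl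
  rw [h, PiLp.norm_sq_eq_of_L2, Fin.sum_univ_succ, dirichlet]
  simp only [real_inner_self_eq_norm_sq]
  rfl

lemma dirichlet_self_nonneg (v : V Ω) : 0 ≤ dirichlet v v :=
  Finset.sum_nonneg fun _ _ => real_inner_self_nonneg

lemma normV_nonneg (v : V Ω) : 0 ≤ normV v := Real.sqrt_nonneg _

lemma normV_sq (v : V Ω) : normV v ^ 2 = dirichlet v v := Real.sq_sqrt (dirichlet_self_nonneg v)

lemma norm_partialDeriv_le (j : Fin 2) (v : V Ω) : ‖V.partialDeriv j v‖ ≤ normV v := by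
  refine Real.le_sqrt_of_sq_le ?_
  rw [dirichlet, ← real_inner_self_eq_norm_sq]
  exact Finset.single_le_sum (f := fun j => inner ℝ (V.partialDeriv j v) (V.partialDeriv j v))
    (fun _ _ => real_inner_self_nonneg) (Finset.mem_univ j)

lemma normV_le_norm (v : V Ω) : normV v ≤ ‖v‖ := by
  refine abs_le_of_sq_le_sq' ?_ (norm_nonneg v) |>.2
  rw [normV_sq, V.norm_sq]
  nlinarith [sq_nonneg ‖V.field v‖]

lemma norm_field_le_norm (v : V Ω) : ‖V.field v‖ ≤ ‖v‖ := by
  refine abs_le_of_sq_le_sq' ?_ (norm_nonneg v) |>.2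
  rw [V.norm_sq]
  linarith [dirichlet_self_nonneg v]

lemma continuous_normV : Continuous (normV : V Ω → ℝ) := by
  refine Real.continuous_sqrt.comp (continuous_finsetSum _ fun j _ => ?_)
  exact (V.partialL j).continuous.inner (V.partialL j).continuous

lemma continuous_field : Continuous (V.field : V Ω → L2 Ω) := V.fieldL.continuous

lemma dirichlet_le_normV_mul (u v : V Ω) : |dirichlet u v| ≤ 2 * (normV u * normV v) := by
  rw [dirichlet, Fin.sum_univ_two]
  have h : ∀ j : Fin 2, |inner ℝ (V.partialDeriv j u) (V.partialDeriv j v)|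
      ≤ normV u * normV v := fun j => (abs_real_inner_le_norm _ _).trans
    (mul_le_mul (norm_partialDeriv_le j u) (norm_partialDeriv_le j v) (norm_nonneg _)
      (normV_nonneg u))
  refine (abs_add_le _ _).trans ?_
  linarith [h 0, h 1]

/-- `v` is represented by the test field `φ`. -/
structure V.IsRepr (v : V Ω) (φ : Plane → Plane) : Prop where
  test : IsTestField Ω φ
  field : V.field v =ᵐ[volume.restrict Ω] φ
  deriv : ∀ j, V.partialDeriv j v =ᵐ[volume.restrict Ω] pderiv j φ

lemma IsTestField.differentiable {φ : Plane → Plane} (h : IsTestField Ω φ) :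
    Differentiable ℝ φ := h.smooth.differentiable (by simp)

lemma IsTestField.add {φ ψ : Plane → Plane} (hφ : IsTestField Ω φ) (hψ : IsTestField Ω ψ) :
    IsTestField Ω (φ + ψ) where
  smooth := hφ.smooth.add hψ.smooth
  compactSupport := hφ.compactSupport.add hψ.compactSupport
  support_subset := (tsupport_add φ ψ).trans (union_subset hφ.support_subset hψ.support_subset)
  divFree x := by
    have h1 := hφ.divFree x
    have h2 := hψ.divFree x
    simp only [pderiv, fderiv_add (hφ.differentiable x) (hψ.differentiable x)] at *
    simp only [add_apply, PiLp.add_apply, Finset.sum_add_distrib, h1, h2,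
      add_zero]

lemma IsTestField.smul {φ : Plane → Plane} (c : ℝ) (hφ : IsTestField Ω φ) :
    IsTestField Ω (c • φ) where
  smooth := hφ.smooth.const_smul c
  compactSupport := hφ.compactSupport.smul_left (f := fun _ => c)
  support_subset := (tsupport_smul_subset_right (fun _ => c) φ).trans hφ.support_subset
  divFree x := by
    have h1 := hφ.divFree x
    simp only [pderiv, fderiv_const_smul (hφ.differentiable x)] at *
    simp only [smul_apply, PiLp.smul_apply, smul_eq_mul, ← Finset.mul_sum, h1,
      mul_zero]

lemma isTestField_zero : IsTestField Ω 0 where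
  smooth := contDiff_const
  compactSupport := HasCompactSupport.zero
  support_subset := by simp
  divFree x := by simp [pderiv]

/-- Test fields already form a linear space `S`, so the span in the definition of `V` adds nothing
and approximants are single test fields. -/
lemma V.dense_isRepr : Dense {v : V Ω | ∃ φ, V.IsRepr v φ} := by
  let S : Submodule ℝ (Jet Ω) :=
    { carrier := {w : Jet Ω | ∃ φ : Plane → Plane, IsTestField Ω φ ∧
        w 0 =ᵐ[volume.restrict Ω] φ ∧ ∀ j : Fin 2, w j.succ =ᵐ[volume.restrict Ω] pderiv j φ}
      add_mem' := by
        rintro v w ⟨φ, hφ, hv, hv'⟩ ⟨ψ, hψ, hw, hw'⟩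
        refine ⟨φ + ψ, hφ.add hψ, ?_, fun j => ?_⟩
        · exact (Lp.coeFn_add (v 0) (w 0)).trans (hv.add hw)
        · refine (Lp.coeFn_add (v j.succ) (w j.succ)).trans (((hv' j).add (hw' j)).trans ?_)
          refine Eventually.of_forall fun x => ?_
          simp [pderiv, fderiv_add (hφ.differentiable x) (hψ.differentiable x)]
      zero_mem' := by
        refine ⟨0, isTestField_zero, Lp.coeFn_zero _ _ _, fun j => (Lp.coeFn_zero _ _ _).trans ?_⟩
        exact Eventually.of_forall fun x => by simp [pderiv]
      smul_mem' := by
        rintro c v ⟨φ, hφ, hv, hv'⟩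
        refine ⟨c • φ, hφ.smul c, ?_, fun j => ?_⟩
        · exact (Lp.coeFn_smul c (v 0)).trans (hv.const_smul c)
        · refine (Lp.coeFn_smul c (v j.succ)).trans (((hv' j).const_smul c).trans ?_)
          refine Eventually.of_forall fun x => ?_
          simp [pderiv, fderiv_const_smul (hφ.differentiable x)] }
  have hV : VSubmodule Ω = S.topologicalClosure := by
    rw [← Submodule.span_eq S]; rfl
  intro v
  have hv : V.toJet v ∈ closure (S : Set (Jet Ω)) := by
    have h : V.toJet v ∈ VSubmodule Ω := Subtype.property (p := fun w => w ∈ VSubmodule Ω) v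
    rw [hV] at h
    exact h
  rw [Metric.mem_closure_iff] at hv ⊢
  intro ε hε
  obtain ⟨w, ⟨φ, h1, h2, h3⟩, hw⟩ := hv ε hε
  have hw' : w ∈ VSubmodule Ω := by
    rw [hV]; exact S.le_topologicalClosure ⟨φ, h1, h2, h3⟩
  exact ⟨(⟨w, hw'⟩ : VSubmodule Ω), ⟨φ, h1, h2, h3⟩, hw⟩

/-- A bounded linear functional on `V` that vanishes on the test fields vanishes. -/
lemma V.eq_zero_of_isRepr {f : V Ω → ℝ} (hf : IsLinearMap ℝ f) {C : ℝ}
    (hC : ∀ v, |f v| ≤ C * ‖v‖) (h : ∀ v φ, V.IsRepr v φ → f v = 0) (v : V Ω) : f v = 0 := by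
  have hc : Continuous f := AddMonoidHomClass.continuous_of_bound (hf.mk' f) C hC
  exact congrFun (hc.ext_on V.dense_isRepr continuous_const
    (fun v hv => by obtain ⟨φ, hφ⟩ := hv; exact h v φ hφ)) v

/-- Lets the weak continuity of a solution, stated against `H`, be tested with elements of `V`. -/
lemma field_mem_H (v : V Ω) : V.field v ∈ H Ω := by
  have hcl : IsClosed {v : V Ω | V.field v ∈ H Ω} :=
    (Submodule.isClosed_topologicalClosure _).preimage continuous_field
  refine closure_minimal (fun v hv => ?_) hcl (V.dense_isRepr v)
  obtain ⟨φ, hφ⟩ := hv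
  exact Submodule.le_topologicalClosure _ (Submodule.subset_span ⟨φ, hφ.test, hφ.field⟩)

/-! ### Poincaré and Ladyzhenskaya inequalities. -/

instance holderTriple_four_four_two : ENNReal.HolderTriple 4 4 2 where
  inv_add_inv_eq_inv := by
    rw [← ENNReal.toReal_eq_toReal_iff' (by simp) (by simp),
      ENNReal.toReal_add (by simp) (by simp)]
    norm_num

lemma norm_fderiv_le_pderiv (φ : Plane → Plane) (x : Plane) :
    ‖fderiv ℝ φ x‖ ≤ ‖pderiv 0 φ x‖ + ‖pderiv 1 φ x‖ := by
  refine ContinuousLinearMap.opNorm_le_bound _ (by positivity) fun y => ?_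
  have hy : y = y 0 • EuclideanSpace.single 0 (1 : ℝ) + y 1 • EuclideanSpace.single 1 (1 : ℝ) := by
    ext i; fin_cases i <;> simp
  have h : fderiv ℝ φ x y = y 0 • pderiv 0 φ x + y 1 • pderiv 1 φ x := by
    conv_lhs => rw [hy]
    rw [map_add, map_smul, map_smul]; rfl
  rw [h, add_mul, mul_comm, mul_comm ‖pderiv 1 φ x‖]
  refine (norm_add_le _ _).trans ?_
  rw [norm_smul, norm_smul]
  have h0 := PiLp.norm_apply_le y 0
  have h1 := PiLp.norm_apply_le y 1
  gcongr

namespace V.IsRepr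

variable {v : V Ω} {φ : Plane → Plane}

lemma support_fderiv_subset (h : V.IsRepr v φ) : Function.support (fderiv ℝ φ) ⊆ Ω :=
  (_root_.support_fderiv_subset ℝ).trans h.test.support_subset

lemma continuous_fderiv (h : V.IsRepr v φ) : Continuous (fderiv ℝ φ) :=
  h.test.smooth.continuous_fderiv (by simp)

lemma eLpNorm_fderiv_restrict (h : V.IsRepr v φ) (p : ℝ≥0∞) :
    eLpNorm (fderiv ℝ φ) p (volume.restrict Ω) = eLpNorm (fderiv ℝ φ) p volume :=
  eLpNorm_restrict_eq_of_support_subset (ε := Plane →L[ℝ] Plane) h.support_fderiv_subset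

lemma eLpNorm_fderiv_le (h : V.IsRepr v φ) :
    eLpNorm (fderiv ℝ φ) 2 (volume.restrict Ω) ≤ ENNReal.ofReal (2 * normV v) := by
  have hj : ∀ j, eLpNorm (pderiv j φ) 2 (volume.restrict Ω) ≤ ENNReal.ofReal (normV v) := fun j => by
    rw [← eLpNorm_congr_ae (h.deriv j), ← Lp.enorm_def, ← ofReal_norm]
    exact ENNReal.ofReal_le_ofReal (norm_partialDeriv_le j v)
  have hm : ∀ j, AEStronglyMeasurable (fun x => ‖pderiv j φ x‖) (volume.restrict Ω) := fun j =>
    (h.continuous_fderiv.clm_apply continuous_const).norm.aestronglyMeasurable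
  calc eLpNorm (fderiv ℝ φ) 2 (volume.restrict Ω)
      ≤ eLpNorm ((fun x => ‖pderiv 0 φ x‖) + fun x => ‖pderiv 1 φ x‖) 2 (volume.restrict Ω) :=
        eLpNorm_mono_real (norm_fderiv_le_pderiv φ)
    _ ≤ _ := eLpNorm_add_le (hm 0) (hm 1) (by norm_num)
    _ ≤ ENNReal.ofReal (normV v) + ENNReal.ofReal (normV v) := by
        rw [eLpNorm_norm, eLpNorm_norm]; exact add_le_add (hj 0) (hj 1)
    _ = _ := by rw [← ENNReal.ofReal_add (normV_nonneg v) (normV_nonneg v), two_mul]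

lemma eLpNorm_field (h : V.IsRepr v φ) (p : ℝ≥0∞) :
    eLpNorm (V.field v) p (volume.restrict Ω) = eLpNorm φ p volume := by
  rw [eLpNorm_congr_ae h.field, eLpNorm_restrict_eq_of_support_subset]
  exact (subset_tsupport φ).trans h.test.support_subset

end V.IsRepr

lemma holderConjugate_finrank_plane :
    NNReal.HolderConjugate (Module.finrank ℝ Plane : ℝ≥0) 2 := by
  rw [finrank_euclideanSpace_fin]
  rw [NNReal.holderConjugate_iff]
  norm_num

/-- The constant of the Gagliardo-Nirenberg-Sobolev inequality in the plane. -/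
def gnsConst : ℝ≥0 := eLpNormLESNormFDerivOneConst (volume : Measure Plane) 2

/-- For a test field, the Sobolev inequality bounds the `L²` norm by the `L¹` norm of the gradient,
and Hölder on a set of finite measure passes to the `L²` norm. Both sides are continuous on `V`, so
density concludes. -/
lemma exists_poincare (hΩ : Bornology.IsBounded Ω) :
    ∃ P : ℝ, 0 ≤ P ∧ ∀ v : V Ω, ‖V.field v‖ ≤ P * normV v := by
  have hfin : volume Ω ≠ ⊤ := hΩ.measure_lt_top.ne
  set P : ℝ := gnsConst * (2 * (volume Ω ^ (1 / 2 : ℝ)).toReal)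
  refine ⟨P, by positivity, fun v => ?_⟩
  have hcl : IsClosed {v : V Ω | ‖V.field v‖ ≤ P * normV v} :=
    isClosed_le continuous_field.norm (continuous_const.mul continuous_normV)
  refine closure_minimal (fun v hv => ?_) hcl (V.dense_isRepr v)
  obtain ⟨φ, h⟩ := hv
  have h1 := eLpNorm_le_eLpNorm_fderiv_one (volume : Measure Plane) (h.test.smooth.of_le (by simp))
    h.test.compactSupport holderConjugate_finrank_plane
  have h2 : eLpNorm (fderiv ℝ φ) 1 volume
      ≤ ENNReal.ofReal (2 * normV v) * volume Ω ^ (1 / 2 : ℝ) := by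
    rw [← h.eLpNorm_fderiv_restrict]
    refine (eLpNorm_le_eLpNorm_mul_rpow_measure_univ (q := 2) (by norm_num)
      h.continuous_fderiv.aestronglyMeasurable).trans ?_
    rw [Measure.restrict_apply_univ]
    refine mul_le_mul' h.eLpNorm_fderiv_le (le_of_eq ?_)
    norm_num
  have h3 : ENNReal.ofReal ‖V.field v‖ ≤ ENNReal.ofReal (P * normV v) := by
    rw [ofReal_norm, Lp.enorm_def, h.eLpNorm_field]
    refine h1.trans ((mul_le_mul_right h2 _).trans (le_of_eq ?_))
    have h4 : volume Ω ^ (1 / 2 : ℝ) ≠ ⊤ := ENNReal.rpow_ne_top_of_nonneg (by norm_num) hfin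
    rw [← ENNReal.ofReal_toReal h4, ← ENNReal.ofReal_mul (by positivity [normV_nonneg v]),
      ← ENNReal.ofReal_coe_nnreal, ← ENNReal.ofReal_mul (by positivity)]
    congr 1
    simp only [P, gnsConst]
    norm_num
    ring
  exact (ENNReal.ofReal_le_ofReal_iff (mul_nonneg (by positivity) (normV_nonneg v))).1 h3

/-- For a test field, apply the Sobolev inequality from `L¹` to `L²` to the scalar `|φ|²`, whose
gradient is at most `2 |φ| |∇φ|`, and use Cauchy–Schwarz. -/
lemma eLpNorm_field_four_le (v : V Ω) :
    eLpNorm (V.field v) 4 (volume.restrict Ω) ^ 2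
      ≤ ENNReal.ofReal (4 * gnsConst * (‖V.field v‖ * normV v)) := by
  have key : ∀ v φ, V.IsRepr (Ω := Ω) v φ → eLpNorm (V.field v) 4 (volume.restrict Ω) ^ 2
      ≤ ENNReal.ofReal (4 * gnsConst * (‖V.field v‖ * normV v)) := by
    intro v φ h
    have hd := h.test.differentiable
    have h1 := eLpNorm_le_eLpNorm_fderiv_one (volume : Measure Plane) (u := fun x => ‖φ x‖ ^ 2)
      ((h.test.smooth.norm_sq ℝ).of_le (by simp))
      (h.test.compactSupport.comp_left (g := fun y => ‖y‖ ^ 2) (by simp))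
      holderConjugate_finrank_plane
    have h2 : eLpNorm (fun x => ‖φ x‖ ^ 2) 2 volume = eLpNorm (V.field v) 4 (volume.restrict Ω) ^ 2 := by
      have := eLpNorm_norm_rpow (p := 2) (μ := volume) φ (q := 2) (by norm_num)
      rw [h.eLpNorm_field]
      norm_num at this ⊢
      exact this
    have h3 : eLpNorm (fderiv ℝ fun x => ‖φ x‖ ^ 2) 1 volume
        ≤ 2 * ENNReal.ofReal ‖V.field v‖ * ENNReal.ofReal (2 * normV v) := by
      have h4 := eLpNorm_le_eLpNorm_mul_eLpNorm_of_nnnorm (p := 2) (q := 2) (r := 1)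
        (μ := volume) h.test.smooth.continuous.aestronglyMeasurable
        h.continuous_fderiv.aestronglyMeasurable
        (fun y L => (2 • (innerSL ℝ y).comp L : Plane →L[ℝ] ℝ)) 2
        (Eventually.of_forall fun x => by
          rw [← NNReal.coe_le_coe]
          simp only [coe_nnnorm, NNReal.coe_mul]
          rw [← Nat.cast_smul_eq_nsmul ℝ, norm_smul, mul_assoc]
          have := (innerSL ℝ (φ x)).opNorm_comp_le (fderiv ℝ φ x)
          rw [innerSL_apply_norm] at this
          norm_num
          exact this)
      rw [ofReal_norm, Lp.enorm_def, h.eLpNorm_field]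
      have h5 : eLpNorm (fderiv ℝ φ) 2 volume ≤ ENNReal.ofReal (2 * normV v) := by
        rw [← h.eLpNorm_fderiv_restrict]
        exact h.eLpNorm_fderiv_le
      refine le_trans (le_of_eq ?_) (h4.trans (mul_le_mul_right h5 _))
      congr 1
      ext1 x
      exact (hd x).hasFDerivAt.norm_sq.fderiv
    have h1' : eLpNorm (fun x => ‖φ x‖ ^ 2) 2 volume
        ≤ gnsConst * eLpNorm (fderiv ℝ fun x => ‖φ x‖ ^ 2) 1 volume := by simpa [gnsConst] using h1
    rw [← h2]
    refine h1'.trans ((mul_le_mul_right h3 _).trans (le_of_eq ?_))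
    have := normV_nonneg v
    have h6 : (2 : ℝ≥0∞) = ENNReal.ofReal 2 := by simp
    rw [← ENNReal.ofReal_coe_nnreal, show (2 * ENNReal.ofReal ‖V.field v‖ : ℝ≥0∞)
      = ENNReal.ofReal 2 * ENNReal.ofReal ‖V.field v‖ from congrArg (· * _) h6,
      ← ENNReal.ofReal_mul (by positivity), ← ENNReal.ofReal_mul (by positivity),
      ← ENNReal.ofReal_mul (by positivity)]
    congr 1
    ring
  -- Convergence in `V` is not yet known to control the `L⁴` norm, so the bound passes to the limit
  -- by Fatou along an almost everywhere convergent subsequence.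
  obtain ⟨s, hs, hsv⟩ := mem_closure_iff_seq_limit.1 (V.dense_isRepr v)
  have hf : Tendsto (fun n => V.field (s n)) atTop (𝓝 (V.field v)) :=
    (continuous_field.tendsto v).comp hsv
  obtain ⟨ns, hns, hae⟩ := (tendstoInMeasure_of_tendsto_Lp hf).exists_seq_tendsto_ae
  have h1 := Lp.eLpNorm_lim_le_liminf_eLpNorm (p := 4)
    (fun n => Lp.aestronglyMeasurable (V.field (s (ns n)))) _ hae
  set B : V Ω → ℝ≥0∞ := fun v => ENNReal.ofReal (4 * gnsConst * (‖V.field v‖ * normV v))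
  have hB : Tendsto (fun n => B (s (ns n)) ^ (1 / 2 : ℝ)) atTop (𝓝 (B v ^ (1 / 2 : ℝ))) := by
    have hc : Continuous fun v => B v ^ (1 / 2 : ℝ) :=
      ENNReal.continuous_rpow_const.comp (ENNReal.continuous_ofReal.comp
        (continuous_const.mul (continuous_field.norm.mul continuous_normV)))
    exact (hc.tendsto v).comp (hsv.comp hns.tendsto_atTop)
  have h2 : eLpNorm (V.field v) 4 (volume.restrict Ω) ≤ B v ^ (1 / 2 : ℝ) := by
    refine h1.trans ?_
    rw [← hB.liminf_eq]
    refine liminf_le_liminf (Eventually.of_forall fun n => ?_)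
    obtain ⟨φ, hφ⟩ := hs (ns n)
    have := ENNReal.rpow_le_rpow (key _ _ hφ) (z := 1 / 2) (by norm_num)
    refine le_trans (le_of_eq ?_) this
    rw [← ENNReal.rpow_natCast, ← ENNReal.rpow_mul]
    norm_num
  refine (pow_le_pow_left' h2 2).trans (le_of_eq ?_)
  change _ = B v
  rw [← ENNReal.rpow_natCast, ← ENNReal.rpow_mul, show (1 / 2 : ℝ) * (2 : ℕ) = 1 by norm_num,
    ENNReal.rpow_one]

/-- The norm of `L⁴(Ω)` on `V`. -/
def norm4 (v : V Ω) : ℝ := (eLpNorm (V.field v) 4 (volume.restrict Ω)).toReal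

lemma norm4_nonneg (v : V Ω) : 0 ≤ norm4 v := ENNReal.toReal_nonneg

lemma memLp_field_four (v : V Ω) : MemLp (V.field v) 4 (volume.restrict Ω) := by
  refine ⟨Lp.aestronglyMeasurable _, lt_top_iff_ne_top.2 fun h => ?_⟩
  have := eLpNorm_field_four_le v
  rw [h, ENNReal.top_pow two_ne_zero, top_le_iff] at this
  exact ENNReal.ofReal_ne_top this

/-- **Ladyzhenskaya's inequality.** -/
lemma norm4_sq_le (v : V Ω) : norm4 v ^ 2 ≤ 4 * gnsConst * (‖V.field v‖ * normV v) := by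
  have h := ENNReal.toReal_mono ENNReal.ofReal_ne_top (eLpNorm_field_four_le v)
  rwa [ENNReal.toReal_pow, ENNReal.toReal_ofReal
    (mul_nonneg (by positivity) (mul_nonneg (norm_nonneg _) (normV_nonneg v)))] at h

lemma norm4_le_norm (v : V Ω) : norm4 v ≤ √(4 * gnsConst) * ‖v‖ := by
  refine abs_le_of_sq_le_sq' ?_ (by positivity) |>.2
  rw [mul_pow, Real.sq_sqrt (by positivity)]
  refine (norm4_sq_le v).trans ?_
  have := mul_le_mul (norm_field_le_norm v) (normV_le_norm v) (normV_nonneg v) (norm_nonneg v)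
  rw [sq]
  gcongr

/-! ### The trilinear form: bounds, linearity, antisymmetry. -/

/-- The `j`-th summand of the integrand of `trilinear`. -/
def trilinearTerm (j : Fin 2) (u v w : V Ω) (x : Plane) : ℝ :=
  (V.field u x) j * inner ℝ (V.partialDeriv j v x) (V.field w x)

lemma aestronglyMeasurable_trilinearTerm (j : Fin 2) (u v w : V Ω) :
    AEStronglyMeasurable (trilinearTerm j u v w) (volume.restrict Ω) :=
  ((EuclideanSpace.proj j : Plane →L[ℝ] ℝ).continuous.comp_aestronglyMeasurable
    (Lp.aestronglyMeasurable (V.field u))).mul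
    ((Lp.aestronglyMeasurable (V.partialDeriv j v)).inner (Lp.aestronglyMeasurable (V.field w)))

/-- Hölder with exponents 4, 2, 4. The resulting integrability is what makes the form trilinear. -/
lemma eLpNorm_trilinearTerm_le (j : Fin 2) (u v w : V Ω) :
    eLpNorm (trilinearTerm j u v w) 1 (volume.restrict Ω)
      ≤ ENNReal.ofReal (norm4 u * normV v * norm4 w) := by
  have hu := (memLp_field_four u).norm
  have hw := (memLp_field_four w).norm
  have hv := (Lp.memLp (V.partialDeriv j v)).norm
  have h1 : ∀ x, ‖trilinearTerm j u v w x‖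
      ≤ (((fun x => ‖V.field u x‖) • fun x => ‖V.field w x‖) •
        fun x => ‖V.partialDeriv j v x‖) x := fun x => by
    change _ ≤ ‖V.field u x‖ * ‖V.field w x‖ * ‖V.partialDeriv j v x‖
    have h2 := PiLp.norm_apply_le (V.field u x) j
    have h3 := norm_inner_le_norm (𝕜 := ℝ) (V.partialDeriv j v x) (V.field w x)
    rw [mul_comm ‖V.partialDeriv j v x‖] at h3
    rw [trilinearTerm, norm_mul, mul_assoc]
    exact mul_le_mul h2 h3 (norm_nonneg _) (norm_nonneg _)
  calc _ ≤ _ := eLpNorm_mono_real h1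
    _ ≤ _ := eLpNorm_smul_le_mul_eLpNorm (p := 2) (q := 2) hv.1 (hu.1.smul hw.1)
    _ ≤ (eLpNorm (V.field u) 4 (volume.restrict Ω) * eLpNorm (V.field w) 4 (volume.restrict Ω))
        * ENNReal.ofReal (normV v) := by
        refine mul_le_mul' ?_ ?_
        · refine (eLpNorm_smul_le_mul_eLpNorm (p := 4) (q := 4) hw.1 hu.1).trans_eq ?_
          rw [eLpNorm_norm, eLpNorm_norm]
        · rw [eLpNorm_norm, ← Lp.enorm_def, ← ofReal_norm]
          exact ENNReal.ofReal_le_ofReal (norm_partialDeriv_le j v)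
    _ = _ := by
        rw [← ENNReal.ofReal_toReal (memLp_field_four u).2.ne,
          ← ENNReal.ofReal_toReal (memLp_field_four w).2.ne,
          ← ENNReal.ofReal_mul ENNReal.toReal_nonneg, ← ENNReal.ofReal_mul (by positivity)]
        congr 1
        simp only [norm4]
        ring

lemma integrable_trilinearTerm (j : Fin 2) (u v w : V Ω) :
    Integrable (trilinearTerm j u v w) (volume.restrict Ω) :=
  memLp_one_iff_integrable.1 ⟨aestronglyMeasurable_trilinearTerm j u v w,
    (eLpNorm_trilinearTerm_le j u v w).trans_lt ENNReal.ofReal_lt_top⟩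

lemma trilinear_eq_sum (u v w : V Ω) :
    trilinear u v w = ∑ j : Fin 2, ∫ x in Ω, trilinearTerm j u v w x :=
  integral_finsetSum _ fun j _ => integrable_trilinearTerm j u v w

lemma abs_trilinear_le (u v w : V Ω) :
    |trilinear u v w| ≤ 2 * (norm4 u * normV v * norm4 w) := by
  have h : ∀ j, |∫ x in Ω, trilinearTerm j u v w x| ≤ norm4 u * normV v * norm4 w := fun j => by
    have h0 : 0 ≤ norm4 u * normV v * norm4 w :=
      mul_nonneg (mul_nonneg (norm4_nonneg u) (normV_nonneg v)) (norm4_nonneg w)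
    have h1 := ENNReal.toReal_mono ENNReal.ofReal_ne_top (eLpNorm_trilinearTerm_le j u v w)
    rw [ENNReal.toReal_ofReal h0, eLpNorm_one_eq_lintegral_enorm] at h1
    refine le_trans ?_ h1
    rw [← Real.norm_eq_abs, ← integral_norm_eq_lintegral_enorm
      (aestronglyMeasurable_trilinearTerm j u v w)]
    exact norm_integral_le_integral_norm _
  rw [trilinear_eq_sum, Fin.sum_univ_two]
  refine (abs_add_le _ _).trans ?_
  linarith [h 0, h 1]

lemma field_add_ae (u v : V Ω) :
    (V.field (u + v) : Plane → Plane) =ᵐ[volume.restrict Ω] V.field u + V.field v := by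
  have : V.field (u + v) = V.field u + V.field v := map_add V.fieldL u v
  rw [this]; exact Lp.coeFn_add _ _

lemma field_smul_ae (c : ℝ) (u : V Ω) :
    (V.field (c • u) : Plane → Plane) =ᵐ[volume.restrict Ω] c • (V.field u : Plane → Plane) := by
  have : V.field (c • u) = c • V.field u := map_smul V.fieldL c u
  rw [this]; exact Lp.coeFn_smul _ _

lemma partialDeriv_add_ae (j : Fin 2) (u v : V Ω) :
    (V.partialDeriv j (u + v) : Plane → Plane)
      =ᵐ[volume.restrict Ω] V.partialDeriv j u + V.partialDeriv j v := by
  have : V.partialDeriv j (u + v) = V.partialDeriv j u + V.partialDeriv j v :=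
    map_add (V.partialL j) u v
  rw [this]; exact Lp.coeFn_add _ _

lemma partialDeriv_smul_ae (j : Fin 2) (c : ℝ) (u : V Ω) :
    (V.partialDeriv j (c • u) : Plane → Plane)
      =ᵐ[volume.restrict Ω] c • (V.partialDeriv j u : Plane → Plane) := by
  have : V.partialDeriv j (c • u) = c • V.partialDeriv j u := map_smul (V.partialL j) c u
  rw [this]; exact Lp.coeFn_smul _ _

lemma isLinearMap_trilinear_left (v w : V Ω) : IsLinearMap ℝ fun u => trilinear u v w where
  map_add u u' := by
    simp only [trilinear_eq_sum]
    rw [← Finset.sum_add_distrib]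
    refine Finset.sum_congr rfl fun j _ => ?_
    rw [← integral_add (integrable_trilinearTerm j u v w) (integrable_trilinearTerm j u' v w)]
    refine integral_congr_ae ?_
    filter_upwards [field_add_ae u u'] with x hx
    simp [trilinearTerm, hx, add_mul]
  map_smul c u := by
    simp only [trilinear_eq_sum]
    rw [Finset.smul_sum]
    refine Finset.sum_congr rfl fun j _ => ?_
    rw [← integral_smul]
    refine integral_congr_ae ?_
    filter_upwards [field_smul_ae c u] with x hx
    simp [trilinearTerm, hx, mul_assoc]

lemma isLinearMap_trilinear_middle (u w : V Ω) : IsLinearMap ℝ fun v => trilinear u v w where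
  map_add v v' := by
    simp only [trilinear_eq_sum]
    rw [← Finset.sum_add_distrib]
    refine Finset.sum_congr rfl fun j _ => ?_
    rw [← integral_add (integrable_trilinearTerm j u v w) (integrable_trilinearTerm j u v' w)]
    refine integral_congr_ae ?_
    filter_upwards [partialDeriv_add_ae j v v'] with x hx
    simp only [trilinearTerm, hx, Pi.add_apply, inner_add_left, mul_add]
  map_smul c v := by
    simp only [trilinear_eq_sum]
    rw [Finset.smul_sum]
    refine Finset.sum_congr rfl fun j _ => ?_
    rw [← integral_smul]
    refine integral_congr_ae ?_
    filter_upwards [partialDeriv_smul_ae j c v] with x hx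
    simp only [trilinearTerm, hx, Pi.smul_apply, real_inner_smul_left, smul_eq_mul]
    ring

lemma isLinearMap_trilinear_right (u v : V Ω) : IsLinearMap ℝ fun w => trilinear u v w where
  map_add w w' := by
    simp only [trilinear_eq_sum]
    rw [← Finset.sum_add_distrib]
    refine Finset.sum_congr rfl fun j _ => ?_
    rw [← integral_add (integrable_trilinearTerm j u v w) (integrable_trilinearTerm j u v w')]
    refine integral_congr_ae ?_
    filter_upwards [field_add_ae w w'] with x hx
    simp only [trilinearTerm, hx, Pi.add_apply, inner_add_right, mul_add]
  map_smul c w := by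
    simp only [trilinear_eq_sum]
    rw [Finset.smul_sum]
    refine Finset.sum_congr rfl fun j _ => ?_
    rw [← integral_smul]
    refine integral_congr_ae ?_
    filter_upwards [field_smul_ae c w] with x hx
    simp only [trilinearTerm, hx, Pi.smul_apply, real_inner_smul_right, smul_eq_mul]
    ring

/-- The two integrands add up to `∑ⱼ φⱼ ∂ⱼ(ψ · χ)`. Integration by parts moves the derivatives onto
`φ`, where they sum to the divergence, which is zero. -/
lemma trilinear_antisymm_of_isRepr {u v w : V Ω} {φ ψ χ : Plane → Plane} (hu : V.IsRepr u φ)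
    (hv : V.IsRepr v ψ) (hw : V.IsRepr w χ) : trilinear u v w + trilinear u w v = 0 := by
  have hφ := hu.test.differentiable
  have hψ := hv.test.differentiable
  have hχ := hw.test.differentiable
  have hφ' : ∀ j, ContDiff ℝ ∞ fun x => φ x j := fun j =>
    (EuclideanSpace.proj j : Plane →L[ℝ] ℝ).contDiff.comp hu.test.smooth
  have hin : ContDiff ℝ ∞ fun x => inner ℝ (ψ x) (χ x) := hv.test.smooth.inner ℝ hw.test.smooth
  have hdφ : ∀ j x y, fderiv ℝ (fun x => φ x j) x y = (fderiv ℝ φ x y) j := fun j x y => by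
    have := ((EuclideanSpace.proj j : Plane →L[ℝ] ℝ).hasFDerivAt.comp x
      (hφ x).hasFDerivAt).fderiv
    exact DFunLike.congr_fun this y
  have hcs : ∀ j, HasCompactSupport fun x => φ x j := fun j =>
    hu.test.compactSupport.comp_left (g := fun y : Plane => y j) (by simp)
  have hcsd : ∀ j (y : Plane), HasCompactSupport fun x => fderiv ℝ (fun x => φ x j) x y :=
    fun j y => (hcs j).fderiv_apply (𝕜 := ℝ) y
  have hcont : ∀ j (y : Plane), Continuous fun x => fderiv ℝ (fun x => φ x j) x y := fun j y =>
    ((hφ' j).continuous_fderiv (by simp)).clm_apply continuous_const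
  have hcont' : ∀ (y : Plane), Continuous fun x => fderiv ℝ (fun x => inner ℝ (ψ x) (χ x)) x y :=
    fun y => (hin.continuous_fderiv (by simp)).clm_apply continuous_const
  have hi1 : ∀ j (y : Plane), Integrable fun x =>
      fderiv ℝ (fun x => φ x j) x y * inner ℝ (ψ x) (χ x) := fun j y =>
    ((hcont j y).mul hin.continuous).integrable_of_hasCompactSupport ((hcsd j y).mul_right)
  have hi2 : ∀ j (y : Plane), Integrable fun x =>
      φ x j * fderiv ℝ (fun x => inner ℝ (ψ x) (χ x)) x y := fun j y =>
    ((hφ' j).continuous.mul (hcont' y)).integrable_of_hasCompactSupport ((hcs j).mul_right)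
  have hi3 : ∀ j, Integrable fun x => φ x j * inner ℝ (ψ x) (χ x) := fun j =>
    ((hφ' j).continuous.mul hin.continuous).integrable_of_hasCompactSupport ((hcs j).mul_right)
  have key : ∀ j, (∫ x in Ω, trilinearTerm j u v w x) + ∫ x in Ω, trilinearTerm j u w v x
      = -∫ x, pderiv j φ x j * inner ℝ (ψ x) (χ x) := fun j => by
    have hibp := integral_mul_fderiv_eq_neg_fderiv_mul_of_integrable (μ := volume)
      (hi1 j (EuclideanSpace.single j 1)) (hi2 j (EuclideanSpace.single j 1)) (hi3 j)
      (fun x _ => (hφ' j).differentiable (by simp) x) (fun x _ => hin.differentiable (by simp) x)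
    replace hibp : ∫ x, φ x j * fderiv ℝ (fun x => inner ℝ (ψ x) (χ x)) x
        (EuclideanSpace.single j 1) = -∫ x, pderiv j φ x j * inner ℝ (ψ x) (χ x) := by
      rw [hibp]
      exact congrArg _ (integral_congr_ae (Eventually.of_forall fun x =>
        congrArg (· * _) (hdφ j x _)))
    rw [← integral_add (integrable_trilinearTerm j u v w) (integrable_trilinearTerm j u w v)]
    refine Eq.trans ?_ ((setIntegral_eq_integral_of_forall_compl_eq_zero (s := Ω) ?_).trans hibp)
    · refine integral_congr_ae ?_
      filter_upwards [hu.field, hv.field, hw.field, hv.deriv j, hw.deriv j] with x h1 h2 h3 h4 h5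
      rw [trilinearTerm, trilinearTerm, h1, h2, h3, h4, h5, fderiv_inner_apply ℝ (hψ x) (hχ x),
        ← mul_add, pderiv, pderiv, real_inner_comm (ψ x)]
      ring
    · intro x hx
      have : φ x = 0 := image_eq_zero_of_notMem_tsupport fun h => hx (hu.test.support_subset h)
      simp [this]
  rw [trilinear_eq_sum, trilinear_eq_sum, ← Finset.sum_add_distrib]
  simp only [key]
  rw [Finset.sum_neg_distrib, ← integral_finsetSum]
  · simp only [← Finset.sum_mul, hu.test.divFree]
    simp
  · intro j _
    refine (hi1 j (EuclideanSpace.single j 1)).congr (Eventually.of_forall fun x => ?_)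
    exact congrArg (· * _) (hdφ j x _)

lemma trilinear_antisymm (u v w : V Ω) : trilinear u v w = -trilinear u w v := by
  rw [eq_neg_iff_add_eq_zero]
  set k : ℝ := √(4 * gnsConst)
  have hk : 0 ≤ k := Real.sqrt_nonneg _
  have hbound : ∀ u v w : V Ω, |trilinear u v w| ≤ 2 * k ^ 2 * ‖u‖ * ‖v‖ * ‖w‖ := fun u v w => by
    refine (abs_trilinear_le u v w).trans ?_
    have := mul_le_mul (mul_le_mul (norm4_le_norm u) (normV_le_norm v) (normV_nonneg v)
      (by positivity)) (norm4_le_norm w) (norm4_nonneg w) (by positivity)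
    calc _ ≤ _ := mul_le_mul_of_nonneg_left this zero_le_two
      _ = _ := by simp only [k]; ring
  have hbound' : ∀ u v w : V Ω, |trilinear u v w + trilinear u w v|
      ≤ 4 * k ^ 2 * ‖u‖ * ‖v‖ * ‖w‖ := fun u v w => by
    refine (abs_add_le _ _).trans ?_
    have h1 := hbound u v w
    have h2 := hbound u w v
    linarith
  have hadd : ∀ {f g : V Ω → ℝ}, IsLinearMap ℝ f → IsLinearMap ℝ g →
      IsLinearMap ℝ fun x => f x + g x := fun hf hg => (hf.mk' _ + hg.mk' _).isLinear
  -- Each argument in turn is reduced to a test field, the other two being fixed; the cubic bound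
  -- supplies continuity in that argument.
  refine V.eq_zero_of_isRepr (f := fun u => trilinear u v w + trilinear u w v)
    (hadd (isLinearMap_trilinear_left v w) (isLinearMap_trilinear_left w v))
    (C := 4 * k ^ 2 * ‖v‖ * ‖w‖) (fun u => (hbound' u v w).trans_eq (by ring)) (fun u φ hu => ?_) u
  refine V.eq_zero_of_isRepr (f := fun v => trilinear u v w + trilinear u w v)
    (hadd (isLinearMap_trilinear_middle u w) (isLinearMap_trilinear_right u w))
    (C := 4 * k ^ 2 * ‖u‖ * ‖w‖) (fun v => (hbound' u v w).trans_eq (by ring)) (fun v ψ hv => ?_) v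
  exact V.eq_zero_of_isRepr (f := fun w => trilinear u v w + trilinear u w v)
    (hadd (isLinearMap_trilinear_right u v) (isLinearMap_trilinear_middle u v))
    (C := 4 * k ^ 2 * ‖u‖ * ‖v‖) (fun w => (hbound' u v w).trans_eq (by ring))
    (fun w χ hw => trilinear_antisymm_of_isRepr hu hv hw) w

lemma trilinear_self (u v : V Ω) : trilinear u v v = 0 := by
  linarith [trilinear_antisymm u v v]

/-- `|b(w, u, w)| ≤ c |w| ‖w‖ ‖u‖`. -/
lemma abs_trilinear_self_le (u w : V Ω) :
    |trilinear w u w| ≤ 8 * gnsConst * ‖V.field w‖ * normV w * normV u := by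
  refine (abs_trilinear_le w u w).trans ?_
  have := mul_le_mul_of_nonneg_right (norm4_sq_le w) (normV_nonneg u)
  nlinarith

/-- Antisymmetry puts the gradient on `w`, leaving two undifferentiated factors `u` for
Ladyzhenskaya. With `|u|` bounded in time, this puts the convection term in `L²(0, T; V')`. -/
lemma abs_trilinear_self_le' (u w : V Ω) :
    |trilinear u u w| ≤ 8 * gnsConst * ‖V.field u‖ * normV u * normV w := by
  rw [trilinear_antisymm, abs_neg]
  exact abs_trilinear_self_le w u

/-- `b(u, u, u - v) - b(v, v, u - v) = b(u - v, u, u - v)`. -/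
lemma trilinear_sub_sub (u v : V Ω) :
    trilinear u u (u - v) - trilinear v v (u - v) = trilinear (u - v) u (u - v) := by
  -- With `w = u - v`, the left side is `b(w, u, w) + b(v, w, w)`, and the last term vanishes.
  have h1 := (isLinearMap_trilinear_left u (u - v)).map_sub u v
  have h2 := (isLinearMap_trilinear_middle v (u - v)).map_sub u v
  have h3 := trilinear_self v (u - v)
  linarith

/-! ### Distributional derivatives on the half-line. -/

lemma intervalIntegrable_of_locallyIntegrableOn_Ioi {E : Type*} [NormedAddCommGroup E] {G : ℝ → E}
    (hG : LocallyIntegrableOn G (Ioi 0)) {a b : ℝ} (ha : 0 < a) (hb : 0 < b) :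
    IntervalIntegrable G volume a b :=
  (hG.integrableOn_compact_subset (t := uIcc a b)
    (fun _ hx => (lt_min ha hb).trans_le hx.1) isCompact_uIcc).intervalIntegrable

/-- A smooth function of compact support in `(0, ∞)` with vanishing integral is the derivative of
such a function. -/
lemma exists_primitive_of_integral_eq_zero {η : ℝ → ℝ} (hη : ContDiff ℝ ∞ η) {p q : ℝ}
    (hsupp : ∀ x ∉ Icc p q, η x = 0) (hint : ∫ x, η x = 0) :
    ∃ ψ : ℝ → ℝ, ContDiff ℝ ∞ ψ ∧ deriv ψ = η ∧ ∀ x ∉ Ioo p q, ψ x = 0 := by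
  have hd : ∀ x, HasDerivAt (fun x => ∫ y in p..x, η y) (η x) x := fun x =>
    intervalIntegral.integral_hasDerivAt_right (hη.continuous.intervalIntegrable _ _)
      hη.continuous.aestronglyMeasurable.stronglyMeasurableAtFilter hη.continuous.continuousAt
  have hd' : deriv (fun x => ∫ y in p..x, η y) = η := funext fun x => (hd x).deriv
  refine ⟨fun x => ∫ y in p..x, η y, ?_, hd', fun x hx => ?_⟩
  · refine contDiff_infty_iff_deriv.2 ⟨fun x => (hd x).differentiableAt, ?_⟩
    rw [hd']; exact hη
  · rcases le_or_gt x p with h | h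
    · refine intervalIntegral.integral_zero_ae ?_
      have : ∀ᵐ y : ℝ, y ≠ p := by simp [ae_iff]
      filter_upwards [this] with y hy hyx
      rw [uIoc_of_ge h] at hyx
      exact hsupp y fun h' => hy (le_antisymm hyx.2 h'.1)
    · have hqx : q ≤ x := not_lt.1 fun h' => hx ⟨h, h'⟩
      change ∫ y in p..x, η y = 0
      rw [intervalIntegral.integral_of_le h.le, ← hint, ← integral_Icc_eq_integral_Ioc]
      refine setIntegral_eq_integral_of_forall_compl_eq_zero fun y hy => hsupp y fun h' => hy ?_
      exact ⟨h'.1, h'.2.trans hqx⟩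

/-- Integration by parts for absolutely continuous functions; the boundary terms vanish with `ψ`. -/
lemma integral_deriv_mul_primitive {G : ℝ → ℝ} {p q s : ℝ} (hG : IntervalIntegrable G volume p q)
    (hs : s ∈ Icc p q) {ψ : ℝ → ℝ} (hψ : ContDiff ℝ ∞ ψ) (hsupp : ∀ x ∉ Ioo p q, ψ x = 0)
    (hsupp' : ∀ x ∉ Icc p q, deriv ψ x = 0) :
    ∫ x, deriv ψ x * ∫ y in s..x, G y = -∫ x, ψ x * G x := by
  have hpq : p ≤ q := hs.1.trans hs.2
  have hs' : s ∈ uIcc p q := by rwa [uIcc_of_le hpq]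
  have h1 := AbsolutelyContinuousOnInterval.integral_mul_deriv_eq_deriv_mul
    ((hψ.of_le (by simp) : ContDiff ℝ 1 ψ).contDiffOn.absolutelyContinuousOnInterval (a := p)
      (b := q)) (hG.absolutelyContinuousOnInterval_intervalIntegral hs')
  rw [hsupp p (by simp), hsupp q (by simp)] at h1
  have h2 : ∫ x in p..q, ψ x * deriv (fun x => ∫ y in s..x, G y) x = ∫ x in p..q, ψ x * G x := by
    refine intervalIntegral.integral_congr_ae ?_
    filter_upwards [hG.ae_hasDerivAt_integral] with x hx hxm
    rw [(hx (uIoc_subset_uIcc hxm) s hs').deriv]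
  rw [h2, intervalIntegral.integral_of_le hpq, intervalIntegral.integral_of_le hpq,
    ← integral_Icc_eq_integral_Ioc, ← integral_Icc_eq_integral_Ioc,
    setIntegral_eq_integral_of_forall_compl_eq_zero, setIntegral_eq_integral_of_forall_compl_eq_zero]
    at h1
  · rw [h1]; ring
  · intro x hx
    rw [hsupp' x hx, zero_mul]
  · intro x hx
    rw [hsupp x fun h => hx (Ioo_subset_Icc_self h), zero_mul]

/-- A continuous function on `(0, ∞)` with a locally integrable distributional derivative is a
primitive of it. -/
lemma sub_eq_integral_of_distributional_deriv {F G : ℝ → ℝ} (hF : ContinuousOn F (Ioi 0))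
    (hG : LocallyIntegrableOn G (Ioi 0))
    (h : ∀ ψ : ℝ → ℝ, ContDiff ℝ ∞ ψ → HasCompactSupport ψ → tsupport ψ ⊆ Ioi 0 →
      ∫ t, deriv ψ t * F t = -∫ t, ψ t * G t) {s t : ℝ} (hs : 0 < s) (ht : 0 < t) :
    F t - F s = ∫ x in s..t, G x := by
  set Γ : ℝ → ℝ := fun x => ∫ y in s..x, G y
  have hΓ : ContinuousOn Γ (Ioi 0) := by
    intro x hx
    have hx : 0 < x := hx
    set p := min s x / 2
    set q := max s x + 1
    have hm : 0 < min s x := lt_min hs hx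
    have hp : p < min s x := half_lt_self hm
    have hq : max s x < q := lt_add_one _
    have hpx : p < x := hp.trans_le (min_le_right _ _)
    have hxq : x < q := (le_max_right _ _).trans_lt hq
    have hsm : s ∈ uIcc p q := by
      rw [uIcc_of_le (hpx.trans hxq).le]
      exact ⟨(hp.trans_le (min_le_left _ _)).le, ((le_max_left _ _).trans_lt hq).le⟩
    have hc := intervalIntegral.continuousOn_primitive_interval'
      (intervalIntegrable_of_locallyIntegrableOn_Ioi hG (half_pos hm) (hx.trans hxq)) hsm
    rw [uIcc_of_le (hpx.trans hxq).le] at hc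
    exact (hc.continuousAt (Icc_mem_nhds hpx hxq)).continuousWithinAt
  -- Du Bois-Reymond's argument: `F₁` has zero distributional derivative and must be shown constant.
  set F₁ : ℝ → ℝ := fun x => F x - Γ x
  have hF₁ : ContinuousOn F₁ (Ioi 0) := hF.sub hΓ
  have hint : ∀ g : ℝ → ℝ, Continuous g → HasCompactSupport g → tsupport g ⊆ Ioi 0 →
      ∀ {F : ℝ → ℝ}, ContinuousOn F (Ioi 0) → Integrable fun x => g x * F x := by
    intro g hg hgc hgs F hF
    refine Continuous.integrable_of_hasCompactSupport (continuous_of_tsupport fun x hx => ?_)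
      hgc.mul_right
    have hx0 : x ∈ Ioi (0 : ℝ) := hgs (tsupport_mul_subset_left hx)
    exact hg.continuousAt.mul (hF.continuousAt (Ioi_mem_nhds hx0))
  have hzero : ∀ η : ℝ → ℝ, ContDiff ℝ ∞ η → HasCompactSupport η → tsupport η ⊆ Ioi 0 →
      ∫ x, η x = 0 → ∫ x, η x * F₁ x = 0 := by
    intro η hη hηc hηs hη0
    -- The base point `s` of the primitive `Γ` is put into the interval, as the integration by parts
    -- requires.
    obtain ⟨p, q, hp, hps, hsq, hsub⟩ : ∃ p q : ℝ, 0 < p ∧ p ≤ s ∧ s ≤ q ∧ tsupport η ⊆ Icc p q := by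
      have hK : IsCompact (insert s (tsupport η)) := hηc.isCompact.insert s
      have hne : (insert s (tsupport η)).Nonempty := ⟨s, mem_insert _ _⟩
      obtain ⟨p, hpm, hp⟩ := hK.exists_isLeast hne
      obtain ⟨q, hqm, hq⟩ := hK.exists_isGreatest hne
      refine ⟨p, q, ?_, hp (mem_insert _ _), hq (mem_insert _ _), fun x hx =>
        ⟨hp (mem_insert_of_mem _ hx), hq (mem_insert_of_mem _ hx)⟩⟩
      rcases hpm with rfl | hpm
      · exact hs
      · exact hηs hpm
    have hsupp : ∀ x ∉ Icc p q, η x = 0 := fun x hx =>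
      image_eq_zero_of_notMem_tsupport fun h' => hx (hsub h')
    obtain ⟨ψ, hψ, hψd, hψs⟩ := exists_primitive_of_integral_eq_zero hη hsupp hη0
    have hts : tsupport ψ ⊆ Icc p q := closure_minimal (fun x hx => by
      by_contra h'
      exact hx (hψs x fun h'' => h' (Ioo_subset_Icc_self h''))) isClosed_Icc
    have h1 := h ψ hψ (HasCompactSupport.of_support_subset_isCompact isCompact_Icc
      ((subset_tsupport ψ).trans hts)) (hts.trans fun x hx => hp.trans_le hx.1)
    have h2 := integral_deriv_mul_primitive
      (intervalIntegrable_of_locallyIntegrableOn_Ioi hG hp (hs.trans_le hsq)) ⟨hps, hsq⟩ hψ hψs (by rwa [hψd])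
    rw [hψd] at h1 h2
    have h3 := hint η hη.continuous hηc hηs hF
    have h4 := hint η hη.continuous hηc hηs hΓ
    simp only [F₁, mul_sub]
    rw [integral_sub h3 h4, h1, h2, sub_self]
  -- A bump of mass one supported in `[s/2, 3s/2]`: subtracting a multiple of it gives any test
  -- function mean zero, so that `hzero` applies.
  let b : ContDiffBump s := ⟨s / 4, s / 2, by positivity, by linarith⟩
  set η₀ := b.normed volume
  have hη₀s : tsupport η₀ ⊆ Ioi 0 := by
    rw [b.tsupport_normed_eq, Real.closedBall_eq_Icc]
    intro x hx
    have : s - s / 2 ≤ x := hx.1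
    change 0 < x
    linarith
  set c := ∫ x, η₀ x * F₁ x
  have hae : ∀ᵐ x, x ∈ Ioi (0 : ℝ) → F₁ x - c = 0 := by
    refine isOpen_Ioi.ae_eq_zero_of_integral_contDiff_smul_eq_zero
      ((hF₁.sub continuousOn_const).locallyIntegrableOn measurableSet_Ioi) fun g hg hgc hgs => ?_
    have h1 := hzero (fun x => g x - (∫ y, g y) * η₀ x)
      (hg.sub (contDiff_const.mul b.contDiff_normed)) (hgc.sub b.hasCompactSupport_normed.mul_left)
      ((tsupport_sub _ _).trans (union_subset hgs ((tsupport_mul_subset_right).trans hη₀s)))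
      (by
        rw [integral_sub (hg.continuous.integrable_of_hasCompactSupport hgc)
          (b.integrable_normed.const_mul _), integral_const_mul, b.integral_normed, mul_one,
          sub_self])
    have h2 := hint g hg.continuous hgc hgs hF₁
    have h3 := hint η₀ b.continuous_normed b.hasCompactSupport_normed hη₀s hF₁
    simp only [sub_mul, mul_assoc] at h1
    rw [integral_sub h2 (h3.const_mul _), integral_const_mul] at h1
    simp only [smul_eq_mul, mul_sub]
    rw [integral_sub h2 ((hg.continuous.integrable_of_hasCompactSupport hgc).mul_const _),
      integral_mul_const]
    exact h1
  have heq : EqOn F₁ (fun _ => c) (Ioi 0) := by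
    refine Measure.eqOn_open_of_ae_eq (μ := volume) ?_ isOpen_Ioi hF₁ continuousOn_const
    rw [EventuallyEq, ae_restrict_iff' measurableSet_Ioi]
    filter_upwards [hae] with x hx hx0 using sub_eq_zero.1 (hx hx0)
  have h1 := heq ht
  have h2 := heq hs
  simp only [F₁, Γ, intervalIntegral.integral_same] at h1 h2
  linarith

/-! ### The energy equality by translations in time. -/

lemma tendsto_average_nhds_zero {Φ : ℝ → ℝ → ℝ} (hΦ : Continuous fun p : ℝ × ℝ => Φ p.1 p.2) :
    Tendsto (fun h => h⁻¹ * ∫ s in 0..h, Φ s h) (𝓝[>] 0) (𝓝 (Φ 0 0)) := by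
  rw [Metric.tendsto_nhds]
  intro ε hε
  have h0 := Metric.continuousAt_iff.1 (hΦ.continuousAt (x := (0, 0))) (ε / 2) (half_pos hε)
  obtain ⟨δ, hδ, hd⟩ := h0
  filter_upwards [Ioo_mem_nhdsGT hδ] with h hh
  have hb : ‖∫ s in 0..h, (Φ s h - Φ 0 0)‖ ≤ ε / 2 * |h - 0| := by
    refine intervalIntegral.norm_integral_le_of_norm_le_const fun s hs => ?_
    rw [uIoc_of_le hh.1.le] at hs
    have := hd (x := (s, h)) (by
      rw [Prod.dist_eq, Real.dist_eq, Real.dist_eq]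
      refine max_lt ?_ ?_
      · rw [sub_zero, abs_of_pos hs.1]; exact hs.2.trans_lt hh.2
      · rw [sub_zero, abs_of_pos hh.1]; exact hh.2)
    exact this.le
  have hc : Continuous fun s => Φ s h := hΦ.comp (continuous_id.prodMk continuous_const)
  rw [intervalIntegral.integral_sub (hc.intervalIntegrable _ _) intervalIntegrable_const,
    intervalIntegral.integral_const, sub_zero, abs_of_pos hh.1, smul_eq_mul,
    Real.norm_eq_abs] at hb
  rw [Real.dist_eq]
  have hpos := hh.1
  have : h⁻¹ * (∫ s in 0..h, Φ s h) - Φ 0 0 = h⁻¹ * ((∫ s in 0..h, Φ s h) - h * Φ 0 0) := by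
    field_simp
  rw [this, abs_mul, abs_of_pos (inv_pos.2 hpos)]
  calc h⁻¹ * |_| ≤ h⁻¹ * (ε / 2 * h) :=
        mul_le_mul_of_nonneg_left hb (inv_pos.2 hpos).le
    _ = ε / 2 := by field_simp
    _ < ε := half_lt_self hε

variable {E L : Type*} [NormedAddCommGroup E] [InnerProductSpace ℝ E]
  [NormedAddCommGroup L] [InnerProductSpace ℝ L]

/-- The pairing over `(a, b)` of the translate of `f` by `s` with the sum of `g` and its translate
by `h`. -/
def translatePairing (f g : Lp E 2 (volume : Measure ℝ)) (a b s h : ℝ) : ℝ :=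
  ∫ t in Ioc a b, inner ℝ (f (s + t)) (g (h + t) + g t)

lemma vadd_mk_ae_eq {E : Type*} [NormedAddCommGroup E] (c : ℝ) (f : Lp E 2 (volume : Measure ℝ)) :
    ⇑(DomAddAct.mk c +ᵥ f) =ᵐ[volume] fun x => f (c + x) := DomAddAct.vadd_Lp_ae_eq _ _

/-- Translations act strongly continuously on `L²`, and the pairing is an inner product in `L²(a,
b)` of restricted translates. -/
lemma continuous_translatePairing (f g : Lp E 2 (volume : Measure ℝ)) (a b : ℝ) :
    Continuous fun p : ℝ × ℝ => translatePairing f g a b p.1 p.2 := by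
  have : Fact ((2 : ℝ≥0∞) ≠ ⊤) := ⟨by simp⟩
  let r := LpToLpRestrictCLM ℝ E ℝ volume 2 (Ioc a b)
  have hτ : ∀ f : Lp E 2 (volume : Measure ℝ), Continuous fun c : ℝ => DomAddAct.mk c +ᵥ f :=
    fun f => DomAddAct.continuous_mk.vadd continuous_const
  have hc : Continuous fun p : ℝ × ℝ =>
      (inner ℝ (r (DomAddAct.mk p.1 +ᵥ f)) (r ((DomAddAct.mk p.2 +ᵥ g) + g)) : ℝ) :=
    (r.continuous.comp ((hτ f).comp continuous_fst)).inner
      (r.continuous.comp (((hτ g).comp continuous_snd).add continuous_const))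
  refine hc.congr fun p => ?_
  rw [L2.inner_def, translatePairing]
  refine integral_congr_ae ?_
  filter_upwards [LpToLpRestrictCLM_coeFn ℝ (Ioc a b) (DomAddAct.mk p.1 +ᵥ f),
    LpToLpRestrictCLM_coeFn ℝ (Ioc a b) ((DomAddAct.mk p.2 +ᵥ g) + g),
    ae_restrict_of_ae (vadd_mk_ae_eq p.1 f), ae_restrict_of_ae (vadd_mk_ae_eq p.2 g),
    ae_restrict_of_ae (Lp.coeFn_add (DomAddAct.mk p.2 +ᵥ g) g)] with t h1 h2 h3 h4 h5
  simp only [r]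
  rw [h1, h2, h3, h5, Pi.add_apply, h4]

/-- Fubini. The shear `(s, t) ↦ (s, s + t)` preserves measure, so the integrand is dominated by a
sum of two integrable squares. -/
lemma integral_translatePairing (f g : Lp E 2 (volume : Measure ℝ)) (a b : ℝ) {h : ℝ}
    (hh : 0 ≤ h) :
    ∫ s in 0..h, translatePairing f g a b s h
      = ∫ t in Ioc a b, ∫ s in 0..h, inner ℝ (f (s + t)) (g (h + t) + g t) := by
  simp only [intervalIntegral.integral_of_le hh, translatePairing]
  refine integral_integral_swap ?_
  set μ := (volume : Measure ℝ).restrict (Ioc 0 h)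
  have hf : Integrable (fun x => ‖f x‖ ^ 2) volume := (Lp.memLp f).integrable_norm_pow two_ne_zero
  set k : ℝ → E := fun t => g (h + t) + g t
  have hkm : MemLp k 2 volume :=
    ((Lp.memLp g).comp_measurePreserving (measurePreserving_add_left volume h)).add (Lp.memLp g)
  have hk : Integrable (fun x => ‖k x‖ ^ 2) volume := hkm.integrable_norm_pow two_ne_zero
  have hmp := measurePreserving_prod_add μ (volume : Measure ℝ)
  have h1 : Integrable (fun p : ℝ × ℝ => ‖f (p.1 + p.2)‖ ^ 2) (μ.prod volume) :=
    (hmp.integrable_comp (hf.comp_snd μ).1).2 (hf.comp_snd μ)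
  have h2 : Integrable (fun p : ℝ × ℝ => ‖k p.2‖ ^ 2) (μ.prod volume) := hk.comp_snd μ
  have hm : AEStronglyMeasurable (fun p : ℝ × ℝ => inner ℝ (f (p.1 + p.2)) (k p.2))
      (μ.prod volume) :=
    (((Lp.stronglyMeasurable f).comp_measurable (measurable_fst.add measurable_snd)).inner
      ((((Lp.stronglyMeasurable g).comp_measurable (measurable_const_add h)).add
        (Lp.stronglyMeasurable g)).comp_measurable measurable_snd)).aestronglyMeasurable
  have h3 : Integrable (fun p : ℝ × ℝ => inner ℝ (f (p.1 + p.2)) (k p.2)) (μ.prod volume) := by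
    refine (h1.add h2).mono' hm (Eventually.of_forall fun p => ?_)
    refine (norm_inner_le_norm _ _).trans ?_
    simp only [Pi.add_apply]
    nlinarith [sq_nonneg (‖f (p.1 + p.2)‖ - ‖k p.2‖), sq_nonneg (‖f (p.1 + p.2)‖ + ‖k p.2‖)]
  refine h3.mono_measure ?_
  exact Measure.prod_mono le_rfl Measure.restrict_le_self

lemma integrableOn_norm_sq {E : Type*} [NormedAddCommGroup E] {W : ℝ → E} {T : ℝ} (hW : MemLp W 2 (volume.restrict (Icc 0 T))) :
    IntegrableOn (fun t => ‖W t‖ ^ 2) (Icc 0 T) := hW.integrable_norm_pow two_ne_zero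

lemma ae_mem_of_forall_nat {p : ℝ → Prop} (h : ∀ n : ℕ, ∀ᵐ t, t ∈ Ioc (0 : ℝ) (n + 1) → p t) :
    ∀ᵐ t ∂(volume.restrict (Ioi (0 : ℝ))), p t := by
  rw [ae_restrict_iff' measurableSet_Ioi]
  filter_upwards [ae_all_iff.2 h] with t ht h0
  obtain ⟨n, hn⟩ := exists_nat_ge t
  exact ht n ⟨h0, hn.trans (by linarith)⟩

/-- **The energy equality.** If `u ∈ L²(0, T; V)` has its derivative in `L²(0, T; V')`, then
`|u|²` is, up to a null set of times, the primitive of `2 ⟨u', u⟩`. -/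
theorem exists_energy_equality (J : E →L[ℝ] L) {w : ℝ → L} {W D : ℝ → E}
    (hJ : ∀ᵐ t ∂(volume.restrict (Ioi (0 : ℝ))), J (W t) = w t)
    (hW : ∀ T > 0, MemLp W 2 (volume.restrict (Icc 0 T)))
    (hD : ∀ T > 0, MemLp D 2 (volume.restrict (Icc 0 T)))
    (hder : ∀ v : E, ∀ s t : ℝ, 0 < s → 0 < t →
      inner ℝ (w t) (J v) - inner ℝ (w s) (J v) = ∫ x in s..t, inner ℝ (D x) v) :
    ∃ G : Set ℝ, (∀ᵐ t ∂(volume.restrict (Ioi (0 : ℝ))), t ∈ G) ∧ ∀ a ∈ G, ∀ b ∈ G,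
      0 < a → a < b → ‖w b‖ ^ 2 - ‖w a‖ ^ 2 = ∫ x in a..b, 2 * inner ℝ (D x) (W x) := by
  have hJ' := (ae_restrict_iff' measurableSet_Ioi).1 hJ
  set y : ℝ → ℝ := fun t => ‖w t‖ ^ 2
  have hyi : ∀ T > 0, IntervalIntegrable y volume 0 T := fun T hT => by
    rw [intervalIntegrable_iff_integrableOn_Ioc_of_le hT.le]
    have h1 := (integrableOn_norm_sq (J.comp_memLp' (hW T hT))).mono_set Ioc_subset_Icc_self
    refine h1.congr ?_
    rw [EventuallyEq, ae_restrict_iff' measurableSet_Ioc]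
    filter_upwards [hJ'] with t ht htm
    simp only [y, Function.comp, ht htm.1]
  have hyi' : ∀ s t, 0 < s → 0 < t → IntervalIntegrable y volume s t := fun s t hs ht =>
    (hyi s hs).symm.trans (hyi t ht)
  -- At these points the averages of `‖w‖²` over `[x, x + h]` tend to its value at `x`.
  refine ⟨{x | HasDerivAt (fun x => ∫ t in 0..x, y t) (y x) x}, ?_, ?_⟩
  · refine ae_mem_of_forall_nat fun n => ?_
    have hn : (0 : ℝ) < n + 1 := by positivity
    filter_upwards [(hyi _ hn).ae_hasDerivAt_integral] with t ht htm
    rw [uIcc_of_le hn.le] at ht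
    exact ht (Ioc_subset_Icc_self htm) 0 ⟨le_rfl, hn.le⟩
  intro a ha b hb ha0 hab
  have hb0 : 0 < b := ha0.trans hab
  -- The cut-off at `b + 1` leaves room for shifts `h < 1` of `(a, b]`.
  set T := b + 1
  have hT : 0 < T := by positivity
  have hDm := (memLp_indicator_iff_restrict measurableSet_Icc).2 (hD T hT)
  have hWm := (memLp_indicator_iff_restrict measurableSet_Icc).2 (hW T hT)
  set f := hDm.toLp
  set g := hWm.toLp
  have hf : ∀ᵐ t, t ∈ Icc 0 T → f t = D t := by
    filter_upwards [hDm.coeFn_toLp] with t h1 h2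
    rw [h1, indicator_of_mem h2]
  have hg : ∀ᵐ t, t ∈ Icc 0 T → g t = W t := by
    filter_upwards [hWm.coeFn_toLp] with t h1 h2
    rw [h1, indicator_of_mem h2]
  -- Write `‖w(t+h)‖² - ‖w(t)‖²` as the inner product of `w(t+h) - w(t)` with `w(t+h) + w(t)`,
  -- express the first factor by `hder` as an integral of `D`, and integrate over `t` in `(a, b]`.
  -- Dividing by `h` and letting `h → 0` gives the claim.
  have hstep : ∀ h ∈ Ioo (0 : ℝ) 1, ((∫ t in 0..b + h, y t) - ∫ t in 0..b, y t)
      - ((∫ t in 0..a + h, y t) - ∫ t in 0..a, y t) = ∫ s in 0..h, translatePairing f g a b s h := by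
    intro h hh
    have hh0 := hh.1
    rw [integral_translatePairing f g a b hh0.le]
    have h1 : ∀ᵐ t, t ∈ Ioc a b → ∫ s in 0..h, inner ℝ (f (s + t)) (g (h + t) + g t)
        = y (t + h) - y t := by
      have hshift := (measurePreserving_add_left volume h).quasiMeasurePreserving
      filter_upwards [hg, hJ', hshift.ae hg, hshift.ae hJ'] with t h1 h2 h3 h4 ht
      have ht0 : 0 < t := ha0.trans ht.1
      have htT : h + t ∈ Icc 0 T := ⟨by linarith, by linarith [ht.2, hh.2]⟩
      have e1 : J (g (h + t) + g t) = w (h + t) + w t := by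
        rw [map_add, h3 htT, h1 ⟨ht0.le, by linarith [ht.2]⟩, h4 (by linarith : 0 < h + t), h2 ht0]
      rw [intervalIntegral.integral_comp_add_right (fun x => inner ℝ (f x) (g (h + t) + g t)),
        zero_add]
      have e2 : ∫ x in t..h + t, inner ℝ (f x) (g (h + t) + g t)
          = ∫ x in t..h + t, inner ℝ (D x) (g (h + t) + g t) := by
        refine intervalIntegral.integral_congr_ae ?_
        filter_upwards [hf] with x hx hxm
        rw [uIoc_of_le (by linarith)] at hxm
        rw [hx ⟨(ht0.trans hxm.1).le, hxm.2.trans htT.2⟩]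
      rw [e2, ← hder _ t (h + t) ht0 (by linarith), e1, ← inner_sub_left, inner_add_right,
        inner_sub_left, inner_sub_left, real_inner_self_eq_norm_sq, real_inner_self_eq_norm_sq,
        real_inner_comm (w t), add_comm h t]
      simp only [y]
      ring
    have h2 : ∫ t in Ioc a b, ∫ s in 0..h, inner ℝ (f (s + t)) (g (h + t) + g t)
        = ∫ t in a..b, (y (t + h) - y t) := by
      rw [intervalIntegral.integral_of_le hab.le]
      refine setIntegral_congr_ae measurableSet_Ioc h1
    have hs : IntervalIntegrable (fun t => y (t + h)) volume a b := by
      have := (hyi' (a + h) (b + h) (by linarith) (by linarith)).comp_add_right h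
      simpa using this
    rw [h2, intervalIntegral.integral_sub hs (hyi' a b ha0 hb0),
      intervalIntegral.integral_comp_add_right y]
    have e1 := intervalIntegral.integral_interval_sub_left (hyi b hb0) (hyi a ha0)
    have e2 := intervalIntegral.integral_interval_sub_left (hyi (b + h) (by linarith))
      (hyi (a + h) (by linarith))
    rw [← e1, ← e2]
    ring
  have hlim1 := tendsto_average_nhds_zero (continuous_translatePairing f g a b)
  have hlim2 := hb.tendsto_slope_zero_right.sub ha.tendsto_slope_zero_right
  have hev : (fun h : ℝ => h⁻¹ • ((∫ t in 0..b + h, y t) - ∫ t in 0..b, y t)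
      - h⁻¹ • ((∫ t in 0..a + h, y t) - ∫ t in 0..a, y t)) =ᶠ[𝓝[>] 0]
      fun h => h⁻¹ * ∫ s in 0..h, translatePairing f g a b s h := by
    filter_upwards [Ioo_mem_nhdsGT one_pos] with h hh
    rw [← hstep h hh, smul_eq_mul, smul_eq_mul]
    ring
  have heq := tendsto_nhds_unique hlim2 (hlim1.congr' hev.symm)
  change y b - y a = _
  rw [heq, translatePairing, intervalIntegral.integral_of_le hab.le]
  refine setIntegral_congr_ae measurableSet_Ioc ?_
  filter_upwards [hf, hg] with t h1 h2 ht
  have htm : t ∈ Icc 0 T := ⟨(ha0.trans ht.1).le, by linarith [ht.2]⟩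
  rw [zero_add, h1 htm, h2 htm, inner_add_right, two_mul]

/-! ### A Grönwall lemma in the absolutely continuous setting. -/

lemma AbsolutelyContinuousOnInterval.lipschitz_comp {f φ : ℝ → ℝ} {a b : ℝ} {K : ℝ≥0}
    (hf : AbsolutelyContinuousOnInterval f a b) (hφ : LipschitzOnWith K φ (f '' uIcc a b)) :
    AbsolutelyContinuousOnInterval (fun x => φ (f x)) a b := by
  rw [absolutelyContinuousOnInterval_iff] at hf ⊢
  intro ε hε
  obtain ⟨δ, hδ, h⟩ := hf (ε / (K + 1)) (by positivity)
  refine ⟨δ, hδ, fun I hI hIδ => ?_⟩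
  calc ∑ i ∈ Finset.range I.1, dist (φ (f (I.2 i).1)) (φ (f (I.2 i).2))
      ≤ ∑ i ∈ Finset.range I.1, K * dist (f (I.2 i).1) (f (I.2 i).2) :=
        Finset.sum_le_sum fun i hi => hφ.dist_le_mul _ (mem_image_of_mem f (hI.1 i hi).1) _
          (mem_image_of_mem f (hI.1 i hi).2)
    _ = K * ∑ i ∈ Finset.range I.1, dist (f (I.2 i).1) (f (I.2 i).2) := (Finset.mul_sum ..).symm
    _ ≤ K * (ε / (K + 1)) := by gcongr; exact (h I hI hIδ).le
    _ < (K + 1) * (ε / (K + 1)) := by gcongr; linarith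
    _ = ε := by field

lemma AbsolutelyContinuousOnInterval.exp_comp {f : ℝ → ℝ} {a b : ℝ}
    (hf : AbsolutelyContinuousOnInterval f a b) :
    AbsolutelyContinuousOnInterval (fun x => Real.exp (f x)) a b := by
  obtain ⟨R, hR⟩ := hf.exists_bound
  obtain ⟨K, hK⟩ := (Real.contDiff_exp (n := 1)).contDiffOn.exists_lipschitzOnWith
    (s := Icc (-R) R) (by simp) (convex_Icc _ _) isCompact_Icc
  refine AbsolutelyContinuousOnInterval.lipschitz_comp hf (hK.mono ?_)
  rintro _ ⟨x, hx, rfl⟩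
  exact abs_le.1 (hR x hx)

/-- A Grönwall lemma with a coefficient that is positive in the mean only. -/
lemma gronwall_of_mean {a t m M δ : ℝ} (hat : a ≤ t) (hm : 0 < m) (hδ : 0 ≤ δ) {y g α : ℝ → ℝ}
    (hya : 0 ≤ y a) (hg : IntervalIntegrable g volume a t) (hα : IntervalIntegrable α volume a t)
    (hy : ∀ᵐ s, s ∈ Ioc a t → y s = y a + ∫ x in a..s, g x)
    (hyt : y t = y a + ∫ x in a..t, g x)
    (hgα : ∀ᵐ s, s ∈ Ioc a t → g s ≤ -(α s * y s) + δ)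
    (hA : ∀ᵐ s, s ∈ Ioc a t → m * (t - s) - M ≤ ∫ x in s..t, α x)
    (hAa : m * (t - a) - M ≤ ∫ x in a..t, α x) :
    y t ≤ Real.exp M * (y a * Real.exp (-(m * (t - a))) + δ / m) := by
  have ha : a ∈ uIcc a t := left_mem_uIcc
  have ht : t ∈ uIcc a t := right_mem_uIcc
  set Y : ℝ → ℝ := fun s => y a + ∫ x in a..s, g x
  -- Based at the final time, so that `A t = 0` and the mean condition reads `A s ≤ M - m (t - s)`:
  -- the integrating factor decays backwards from `t`.
  set A : ℝ → ℝ := fun s => ∫ x in t..s, α x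
  have hY : AbsolutelyContinuousOnInterval Y a t :=
    ((contDiffOn_const (c := y a)).absolutelyContinuousOnInterval).add
      (hg.absolutelyContinuousOnInterval_intervalIntegral ha)
  have hE : AbsolutelyContinuousOnInterval (fun s => Real.exp (A s)) a t :=
    AbsolutelyContinuousOnInterval.exp_comp
      (hα.absolutelyContinuousOnInterval_intervalIntegral ht)
  have hYE := hY.mul hE
  have hF : ∀ s : ℝ, HasDerivAt (fun s => δ * Real.exp M / m * Real.exp (-(m * (t - s))))
      (δ * Real.exp (M - m * (t - s))) s := fun s => by
    have h1 : HasDerivAt (fun s => -(m * (t - s))) m s := by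
      exact (((hasDerivAt_id s).const_sub t).const_mul m).fun_neg.congr_deriv (by ring)
    refine (h1.exp.const_mul (δ * Real.exp M / m)).congr_deriv ?_
    rw [sub_eq_add_neg M, Real.exp_add]
    field_simp
  have hcont : Continuous fun s => δ * Real.exp (M - m * (t - s)) := by fun_prop
  have hle : ∫ s in a..t, deriv (Y * fun s => Real.exp (A s)) s
      ≤ ∫ s in a..t, δ * Real.exp (M - m * (t - s)) := by
    refine intervalIntegral.integral_mono_ae_restrict hat hYE.intervalIntegrable_deriv
      (hcont.intervalIntegrable _ _) ?_
    rw [EventuallyLE, ae_restrict_iff' measurableSet_Icc]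
    have hne : ∀ᵐ s : ℝ, s ≠ a := by simp [ae_iff]
    filter_upwards [hne, hg.ae_hasDerivAt_integral, hα.ae_hasDerivAt_integral, hy, hgα, hA]
      with s hsa h1 h2 h3 h4 h5 hs
    have hs' : s ∈ Ioc a t := ⟨lt_of_le_of_ne hs.1 hsa.symm, hs.2⟩
    have hsu : s ∈ uIcc a t := by rwa [uIcc_of_le hat]
    have hd := ((h1 hsu a ha).const_add (y a)).mul (h2 hsu t ht).exp
    rw [hd.deriv]
    have hAs : A s ≤ M - m * (t - s) := by
      have := h5 hs'
      rw [intervalIntegral.integral_symm] at this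
      simp only [A]
      linarith
    have h6 := h4 hs'
    rw [h3 hs'] at h6
    calc _ = (g s + α s * (y a + ∫ x in a..s, g x)) * Real.exp (A s) := by simp only [A]; ring
      _ ≤ δ * Real.exp (A s) := by
          gcongr
          linarith
      _ ≤ _ := by gcongr
  rw [hYE.integral_deriv_eq_sub, intervalIntegral.integral_eq_sub_of_hasDerivAt (fun s _ => hF s)
    (hcont.intervalIntegrable _ _)] at hle
  have e1 : A t = 0 := intervalIntegral.integral_same
  have e2 : Y a = y a := by simp [Y]
  have e3 : Real.exp (A a) ≤ Real.exp M * Real.exp (-(m * (t - a))) := by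
    rw [← Real.exp_add]
    gcongr
    have : A a = -∫ x in a..t, α x := intervalIntegral.integral_symm _ _
    linarith
  simp only [Pi.mul_apply, e1, e2, Real.exp_zero, mul_one, sub_self, mul_zero, neg_zero] at hle
  have e4 : 0 ≤ δ * Real.exp M / m * Real.exp (-(m * (t - a))) := by positivity
  have e5 := mul_le_mul_of_nonneg_left e3 hya
  have e6 : y t = Y t := hyt
  have e7 : Real.exp M * (δ / m) = δ * Real.exp M / m := by ring
  rw [e6, mul_add, e7]
  linarith

/-! ### Functionals on `V`, comparison of norms, integrability in time. -/

lemma eventually_aeTop {p : ℝ → Prop} (h : ∀ᶠ t in aeTop, p t) :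
    ∃ T : ℝ, 0 < T ∧ ∀ᵐ t, T < t → p t := by
  obtain ⟨s, hs, t, ht, hst⟩ := eventually_inf.1 h
  obtain ⟨T, hT⟩ := mem_atTop_sets.1 hs
  refine ⟨max T 1, by positivity, ?_⟩
  filter_upwards [ht] with x hx hxT
  exact hst x ⟨hT x ((le_max_left _ _).trans hxT.le), hx⟩

/-- The Riesz representation of a functional on `V`. -/
def riesz (l : VDual Ω) : V Ω := (InnerProductSpace.toDual ℝ (V Ω)).symm l

lemma inner_riesz (l : VDual Ω) (v : V Ω) : inner ℝ (riesz l) v = l v :=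
  InnerProductSpace.toDual_symm_apply

lemma memLp_riesz {μ : Measure ℝ} {l : ℝ → VDual Ω} (hl : MemLp l 2 μ) :
    MemLp (fun t => riesz (l t)) 2 μ :=
  hl.congr_norm ((InnerProductSpace.toDual ℝ (V Ω)).symm.continuous.comp_aestronglyMeasurable hl.1)
    (Eventually.of_forall fun t => ((InnerProductSpace.toDual ℝ (V Ω)).symm.norm_map (l t)).symm)

/-- Homogeneity, after normalizing `v`; when `normV v = 0`, Poincaré forces `v = 0`. -/
lemma abs_apply_le_of_normVDual_le {P : ℝ} (hP : ∀ v : V Ω, ‖V.field v‖ ≤ P * normV v)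
    {l : VDual Ω} {c : ℝ} (hc : 0 ≤ c) (hl : normVDual l ≤ ENNReal.ofReal c) (v : V Ω) :
    |l v| ≤ c * normV v := by
  rcases (normV_nonneg v).eq_or_lt with h | h
  · have h1 : ‖v‖ ^ 2 = 0 := by
      have := hP v
      rw [← h, mul_zero] at this
      rw [V.norm_sq, ← normV_sq, ← h, le_antisymm this (norm_nonneg _)]
      norm_num
    have h2 : v = 0 := norm_eq_zero.1 (pow_eq_zero_iff two_ne_zero |>.1 h1)
    rw [← h, h2]; simp
  · have hsmul : normV ((normV v)⁻¹ • v) = 1 := by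
      have h1 : dirichlet ((normV v)⁻¹ • v) ((normV v)⁻¹ • v)
          = (normV v)⁻¹ ^ 2 * dirichlet v v := by
        simp only [dirichlet, Finset.mul_sum]
        refine Finset.sum_congr rfl fun j _ => ?_
        have : V.partialDeriv j ((normV v)⁻¹ • v) = (normV v)⁻¹ • V.partialDeriv j v :=
          map_smul (V.partialL j) _ v
        rw [this, real_inner_smul_left, real_inner_smul_right]
        ring
      rw [normV, h1, ← normV_sq, ← mul_pow, inv_mul_cancel₀ h.ne']
      simp
    have h1 : ‖l ((normV v)⁻¹ • v)‖ₑ ≤ ENNReal.ofReal c :=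
      (le_iSup₂ (f := fun (v : V Ω) (_ : normV v ≤ 1) => ‖l v‖ₑ) _ hsmul.le).trans hl
    rw [← ofReal_norm, ENNReal.ofReal_le_ofReal_iff hc, map_smul, norm_smul, norm_inv,
      Real.norm_of_nonneg h.le, inv_mul_le_iff₀ h, Real.norm_eq_abs] at h1
    linarith

lemma dirichlet_sub_left (u v w : V Ω) : dirichlet (u - v) w = dirichlet u w - dirichlet v w := by
  simp only [dirichlet, ← Finset.sum_sub_distrib]
  refine Finset.sum_congr rfl fun j _ => ?_
  have : V.partialDeriv j (u - v) = V.partialDeriv j u - V.partialDeriv j v :=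
    map_sub (V.partialL j) u v
  rw [this, inner_sub_left]

lemma exists_normH1_le {P : ℝ} (hP : ∀ v : V Ω, ‖V.field v‖ ≤ P * normV v) :
    ∃ Q : ℝ, 0 < Q ∧ ∀ v : V Ω, normH1 v ≤ Q * normV v := by
  have h0 : 0 ≤ volume.real Ω ^ (-(1 / 2) : ℝ) := by positivity
  refine ⟨√(volume.real Ω ^ (-(1 / 2) : ℝ) * P ^ 2 + 1), by positivity, fun v => ?_⟩
  rw [normH1]
  refine Real.sqrt_le_iff.2 ⟨mul_nonneg (Real.sqrt_nonneg _) (normV_nonneg v), ?_⟩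
  rw [mul_pow, Real.sq_sqrt (by positivity), ← normV_sq]
  have h1 := pow_le_pow_left₀ (norm_nonneg _) (hP v) 2
  have h2 := mul_le_mul_of_nonneg_left h1 h0
  nlinarith

lemma intervalIntegrable_inner {E : Type*} [NormedAddCommGroup E] [InnerProductSpace ℝ E]
    {D W : ℝ → E} (hW : ∀ T > 0, MemLp W 2 (volume.restrict (Icc 0 T)))
    (hD : ∀ T > 0, MemLp D 2 (volume.restrict (Icc 0 T))) {a b : ℝ} (ha : 0 < a) (hb : 0 < b) :
    IntervalIntegrable (fun x => inner ℝ (D x) (W x)) volume a b := by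
  have hT : 0 < max a b := ha.trans_le (le_max_left _ _)
  have h1 := hD _ hT
  have h2 := hW _ hT
  have h3 : IntegrableOn (fun x => inner ℝ (D x) (W x)) (Icc 0 (max a b)) := by
    refine ((integrableOn_norm_sq h1).add (integrableOn_norm_sq h2)).mono' (h1.1.inner h2.1)
      (Eventually.of_forall fun t => ?_)
    refine (norm_inner_le_norm _ _).trans ?_
    simp only [Pi.add_apply]
    nlinarith [sq_nonneg (‖D t‖ - ‖W t‖), sq_nonneg (‖D t‖ + ‖W t‖)]
  refine (h3.mono_set fun x hx => ?_).intervalIntegrable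
  exact ⟨(lt_min ha hb).le.trans hx.1, hx.2⟩

lemma intervalIntegrable_normV_sq {W : ℝ → V Ω}
    (hW : ∀ T > 0, MemLp W 2 (volume.restrict (Icc 0 T))) {a b : ℝ} (ha : 0 < a) (hb : 0 < b) :
    IntervalIntegrable (fun x => normV (W x) ^ 2) volume a b := by
  have h : ∀ j : Fin 2, IntervalIntegrable (fun x => inner ℝ (V.partialDeriv j (W x))
      (V.partialDeriv j (W x))) volume a b := fun j =>
    intervalIntegrable_inner (fun T hT => (V.partialL j).comp_memLp' (hW T hT))
      (fun T hT => (V.partialL j).comp_memLp' (hW T hT)) ha hb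
  simp only [normV_sq, dirichlet, Fin.sum_univ_two]
  exact (h 0).add (h 1)

/-! ### Energy estimates for weak solutions and their differences. -/

namespace WeakSolution

variable {ν : ℝ} {f : ℝ → VDual Ω} {u₀ : H Ω}

/-- The equation itself upgrades `du/dt` from locally integrable to square integrable: the
convection term is at most a constant times `|u| ‖u‖`, with `|u|` essentially bounded. The energy
equality needs this. -/
lemma memLp_dt (u : WeakSolution Ω ν f u₀) (hν : 0 < ν) (hf : IsForcing f) {T : ℝ} (hT : 0 < T) :
    MemLp u.dt 2 (volume.restrict (Icc 0 T)) := by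
  have hsub : volume.restrict (Icc 0 T) ≤ volume.restrict (Ici (0 : ℝ)) :=
    Measure.restrict_mono Icc_subset_Ici_self le_rfl
  have hIoi : (volume : Measure ℝ).restrict (Ioi 0) = volume.restrict (Ici 0) :=
    Measure.restrict_congr_set Ioi_ae_eq_Ici
  rw [← hIoi] at hsub
  have hm : AEStronglyMeasurable u.dt (volume.restrict (Icc 0 T)) :=
    u.dt_locallyIntegrable.aestronglyMeasurable.mono_measure hsub
  set B := (eLpNormEssSup u.toH (volume.restrict (Icc 0 T))).toReal
  have hB : ∀ᵐ t ∂(volume.restrict (Icc 0 T)), ‖u.toH t‖ ≤ B := by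
    have hfin := (u.memLinfty T hT).2.ne
    rw [eLpNorm_exponent_top] at hfin
    filter_upwards [ae_le_eLpNormEssSup (f := u.toH) (μ := volume.restrict (Icc 0 T))] with t ht
    have := ENNReal.toReal_mono hfin ht
    rwa [toReal_enorm] at this
  have hdom : MemLp (fun t => ‖f t‖ + (2 * ν + 8 * gnsConst * B) * ‖u.toV t‖) 2
      (volume.restrict (Icc 0 T)) :=
    (hf T hT).norm.add ((u.memL2 T hT).norm.const_mul _)
  have hB0 : 0 ≤ B := ENNReal.toReal_nonneg
  refine hdom.mono' hm ?_
  filter_upwards [hB, ae_mono hsub u.equation, ae_mono hsub u.toV_eq] with t h1 h2 h3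
  refine ContinuousLinearMap.opNorm_le_bound _ (by positivity) fun v => ?_
  have e1 : u.dt t v = f t v - ν * dirichlet (u.toV t) v - trilinear (u.toV t) (u.toV t) v := by
    linarith [h2 v]
  have hU := normV_le_norm (u.toV t)
  have hv := normV_le_norm v
  have hUv := mul_le_mul hU hv (normV_nonneg v) (norm_nonneg _)
  have e2 : |f t v| ≤ ‖f t‖ * ‖v‖ := (f t).le_opNorm v
  have e3 : |ν * dirichlet (u.toV t) v| ≤ 2 * ν * (‖u.toV t‖ * ‖v‖) := by
    rw [abs_mul, abs_of_pos hν]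
    nlinarith [dirichlet_le_normV_mul (u.toV t) v]
  have e4 : |trilinear (u.toV t) (u.toV t) v| ≤ 8 * gnsConst * B * (‖u.toV t‖ * ‖v‖) := by
    refine (abs_trilinear_self_le' (u.toV t) v).trans ?_
    rw [mul_assoc, h3]
    have : ‖(u.toH t : L2 Ω)‖ ≤ B := h1
    have h0 := mul_nonneg (normV_nonneg (u.toV t)) (normV_nonneg v)
    gcongr
  rw [Real.norm_eq_abs, e1]
  refine (abs_sub _ _).trans ?_
  refine (add_le_add_left (abs_sub _ _) _).trans ?_
  linarith

lemma inner_sub_inner_eq_integral (u : WeakSolution Ω ν f u₀) (v : V Ω) {s t : ℝ} (hs : 0 < s)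
    (ht : 0 < t) : inner ℝ (u.toH t : L2 Ω) (V.field v) - inner ℝ (u.toH s : L2 Ω) (V.field v)
      = ∫ x in s..t, u.dt x v := by
  have hG : LocallyIntegrableOn (fun x => u.dt x v) (Ioi 0) := fun x hx => by
    obtain ⟨S, hS, hi⟩ := u.dt_locallyIntegrable x hx
    exact ⟨S, hS, (ContinuousLinearMap.apply ℝ ℝ v).integrable_comp hi⟩
  exact sub_eq_integral_of_distributional_deriv
    (F := fun t => inner ℝ (u.toH t : L2 Ω) (V.field v))
    ((u.weaklyContinuous ⟨V.field v, field_mem_H v⟩).mono Ioi_subset_Ici_self) hG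
    (u.dt_isDeriv v) hs ht

lemma intervalIntegrable_dt_apply (u : WeakSolution Ω ν f u₀) (v : V Ω) {s t : ℝ} (hs : 0 < s)
    (ht : 0 < t) : IntervalIntegrable (fun x => u.dt x v) volume s t := by
  have h := intervalIntegrable_of_locallyIntegrableOn_Ioi u.dt_locallyIntegrable hs ht
  exact ⟨(ContinuousLinearMap.apply ℝ ℝ v).integrable_comp h.1,
    (ContinuousLinearMap.apply ℝ ℝ v).integrable_comp h.2⟩

end WeakSolution

lemma ae_restrict_Ioi_zero {p : ℝ → Prop} :
    (∀ᵐ t ∂(volume.restrict (Ioi (0 : ℝ))), p t) ↔ ∀ᵐ t : ℝ, 0 < t → p t :=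
  ae_restrict_iff' measurableSet_Ioi

/-- A conull subset of `(0, ∞)` has arbitrarily large elements. -/
lemma exists_gt_mem_of_ae {G : Set ℝ} (hG : ∀ᵐ t : ℝ, 0 < t → t ∈ G) {T : ℝ} (hT : 0 ≤ T) :
    ∃ a ∈ G, T < a := by
  by_contra! h
  have h1 : volume (Ioi T) = 0 := by
    refine measure_mono_null (fun t ht => ?_) hG
    exact fun h' => (h t (h' (hT.trans_lt ht))).not_gt ht
  simp at h1

namespace WeakSolution

variable {ν : ℝ} {f g : ℝ → VDual Ω} {u₀ v₀ : H Ω}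

lemma memLp_riesz_dt (u : WeakSolution Ω ν f u₀) (hν : 0 < ν) (hf : IsForcing f) :
    ∀ T > 0, MemLp (fun t => riesz (u.dt t)) 2 (volume.restrict (Icc 0 T)) :=
  fun _ hT => memLp_riesz (u.memLp_dt hν hf hT)

lemma exists_energy_equality (u : WeakSolution Ω ν f u₀) (hν : 0 < ν) (hf : IsForcing f) :
    ∃ G : Set ℝ, (∀ᵐ t : ℝ, 0 < t → t ∈ G) ∧ ∀ a ∈ G, ∀ b ∈ G, 0 < a → a < b →
      ‖u.toH b‖ ^ 2 - ‖u.toH a‖ ^ 2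
        = ∫ x in a..b, 2 * inner ℝ (riesz (u.dt x)) (u.toV x) := by
  obtain ⟨G, hG, h⟩ := NavierStokes.exists_energy_equality V.fieldL
    (w := fun t => (u.toH t : L2 Ω)) (W := u.toV) (D := fun t => riesz (u.dt t))
    u.toV_eq u.memL2 (u.memLp_riesz_dt hν hf) (fun v s t hs ht => by
      simp only [V.fieldL_apply, inner_riesz]
      exact u.inner_sub_inner_eq_integral v hs ht)
  exact ⟨G, ae_restrict_Ioi_zero.1 hG, h⟩

lemma exists_energy_equality_sub (u : WeakSolution Ω ν f u₀) (v : WeakSolution Ω ν g v₀)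
    (hν : 0 < ν) (hf : IsForcing f) (hg : IsForcing g) :
    ∃ G : Set ℝ, (∀ᵐ t : ℝ, 0 < t → t ∈ G) ∧ ∀ a ∈ G, ∀ b ∈ G, 0 < a → a < b →
      ‖u.toH b - v.toH b‖ ^ 2 - ‖u.toH a - v.toH a‖ ^ 2
        = ∫ x in a..b, 2 * inner ℝ (riesz (u.dt x) - riesz (v.dt x)) (u.toV x - v.toV x) := by
  obtain ⟨G, hG, h⟩ := NavierStokes.exists_energy_equality V.fieldL
    (w := fun t => ((u.toH t - v.toH t : H Ω) : L2 Ω)) (W := fun t => u.toV t - v.toV t)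
    (D := fun t => riesz (u.dt t) - riesz (v.dt t))
    (by
      filter_upwards [u.toV_eq, v.toV_eq] with t h1 h2
      rw [map_sub, V.fieldL_apply, V.fieldL_apply, h1, h2, Submodule.coe_sub])
    (fun T hT => (u.memL2 T hT).sub (v.memL2 T hT))
    (fun T hT => (u.memLp_riesz_dt hν hf T hT).sub (v.memLp_riesz_dt hν hg T hT))
    (fun w s t hs ht => by
      simp only [V.fieldL_apply, inner_riesz, inner_sub_left, Submodule.coe_sub]
      rw [intervalIntegral.integral_sub (u.intervalIntegrable_dt_apply w hs ht)
        (v.intervalIntegrable_dt_apply w hs ht), ← u.inner_sub_inner_eq_integral w hs ht,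
        ← v.inner_sub_inner_eq_integral w hs ht]
      ring)
  exact ⟨G, ae_restrict_Ioi_zero.1 hG, h⟩

/-- Testing with `u` removes convection, and Young's inequality spends half of the dissipation on
the forcing. -/
lemma two_mul_inner_riesz_dt_le (u : WeakSolution Ω ν f u₀) (hν : 0 < ν) {P : ℝ}
    (hP : ∀ v : V Ω, ‖V.field v‖ ≤ P * normV v) {F T : ℝ} (hF : 0 ≤ F) (hT : 0 < T)
    (hfF : ∀ᵐ t, T < t → normVDual (f t) ≤ ENNReal.ofReal F) :
    ∀ᵐ t, T < t → 2 * inner ℝ (riesz (u.dt t)) (u.toV t)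
      ≤ -(ν * normV (u.toV t) ^ 2) + F ^ 2 / ν := by
  filter_upwards [hfF, ae_restrict_Ioi_zero.1 u.equation] with t h1 h2 ht
  have h3 := abs_apply_le_of_normVDual_le hP hF (h1 ht) (u.toV t)
  have h4 := h2 (hT.trans ht) (u.toV t)
  rw [trilinear_self, ← normV_sq] at h4
  rw [inner_riesz]
  have h5 := le_of_abs_le h3
  have h6 : 2 * (F * normV (u.toV t)) ≤ ν * normV (u.toV t) ^ 2 + F ^ 2 / ν := by
    have h7 := sq_nonneg (ν * normV (u.toV t) - F)
    have h8 : ν * normV (u.toV t) ^ 2 + F ^ 2 / ν - 2 * (F * normV (u.toV t))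
        = (ν * normV (u.toV t) - F) ^ 2 / ν := by field_simp; ring
    have h9 : 0 ≤ (ν * normV (u.toV t) - F) ^ 2 / ν := by positivity
    linarith
  linarith

/-- In the mean over long times, `‖u‖²` is at most `F² / ν²`. -/
lemma exists_integral_normV_sq_le (u : WeakSolution Ω ν f u₀) (hν : 0 < ν) (hf : IsForcing f)
    {P : ℝ} (hP0 : 0 < P) (hP : ∀ v : V Ω, ‖V.field v‖ ≤ P * normV v) {F T : ℝ} (hF : 0 ≤ F)
    (hT : 0 < T) (hfF : ∀ᵐ t, T < t → normVDual (f t) ≤ ENNReal.ofReal F) :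
    ∃ G : Set ℝ, (∀ᵐ t : ℝ, 0 < t → t ∈ G) ∧
      ∃ a B : ℝ, T < a ∧ 0 ≤ B ∧ ∀ s ∈ G, ∀ t ∈ G, a < s → s < t →
      ∫ x in s..t, normV (u.toV x) ^ 2 ≤ B + (t - s) * (F ^ 2 / ν ^ 2) := by
  obtain ⟨G, hG, hE⟩ := u.exists_energy_equality hν hf
  obtain ⟨a, haG, haT⟩ := exists_gt_mem_of_ae hG hT.le
  have ha0 : 0 < a := hT.trans haT
  have hgint : ∀ s t, 0 < s → 0 < t →
      IntervalIntegrable (fun x => 2 * inner ℝ (riesz (u.dt x)) (u.toV x)) volume s t :=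
    fun s t hs ht => (intervalIntegrable_inner u.memL2 (u.memLp_riesz_dt hν hf) hs ht).const_mul 2
  have hle := u.two_mul_inner_riesz_dt_le hν hP hF hT hfF
  -- By Poincaré the dissipation damps `|u|²` at the constant rate `ν / P²`. The resulting uniform
  -- bound makes `B` independent of `s` and `t`.
  have hbound : ∀ t ∈ G, a < t → ‖u.toH t‖ ^ 2 ≤ ‖u.toH a‖ ^ 2 + F ^ 2 / ν / (ν / P ^ 2) := by
    intro t htG hat
    have hgr := gronwall_of_mean (a := a) (t := t) (m := ν / P ^ 2) (M := 0) (δ := F ^ 2 / ν) hat.le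
      (by positivity) (by positivity) (y := fun t => ‖u.toH t‖ ^ 2)
      (g := fun x => 2 * inner ℝ (riesz (u.dt x)) (u.toV x)) (α := fun _ => ν / P ^ 2)
      (by positivity) (hgint a t ha0 (ha0.trans hat)) intervalIntegrable_const
      (by
        filter_upwards [hG] with s hs hsm
        linarith [hE a haG s (hs (ha0.trans hsm.1)) ha0 hsm.1])
      (by linarith [hE a haG t htG ha0 hat])
      (by
        filter_upwards [hle, ae_restrict_Ioi_zero.1 u.toV_eq] with s h1 h2 hs
        refine (h1 (haT.trans hs.1)).trans ?_
        have h3 := hP (u.toV s)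
        rw [h2 (ha0.trans hs.1)] at h3
        have h4 : ‖u.toH s‖ ≤ P * normV (u.toV s) := h3
        have h5 := pow_le_pow_left₀ (norm_nonneg _) h4 2
        have h6 : ν / P ^ 2 * ‖u.toH s‖ ^ 2 ≤ ν / P ^ 2 * (P * normV (u.toV s)) ^ 2 := by gcongr
        have h7 : ν / P ^ 2 * (P * normV (u.toV s)) ^ 2 = ν * normV (u.toV s) ^ 2 := by field_simp
        linarith)
      (Eventually.of_forall fun s _ => by
        rw [intervalIntegral.integral_const, smul_eq_mul]; linarith)
      (by rw [intervalIntegral.integral_const, smul_eq_mul]; linarith)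
    rw [Real.exp_zero, one_mul] at hgr
    refine hgr.trans (add_le_add_left ?_ _)
    refine mul_le_of_le_one_right (by positivity) (Real.exp_le_one_iff.2 ?_)
    have : 0 ≤ ν / P ^ 2 * (t - a) := mul_nonneg (by positivity) (by linarith)
    linarith
  refine ⟨G, hG, a, (‖u.toH a‖ ^ 2 + F ^ 2 / ν / (ν / P ^ 2)) / ν, haT,
    by positivity, fun s hs t ht has hst => ?_⟩
  have hs0 : 0 < s := ha0.trans has
  have h1 := hE s hs t ht hs0 hst
  have hq := intervalIntegrable_normV_sq u.memL2 hs0 (hs0.trans hst)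
  have h2 : ∫ x in s..t, 2 * inner ℝ (riesz (u.dt x)) (u.toV x)
      ≤ ∫ x in s..t, (-(ν * normV (u.toV x) ^ 2) + F ^ 2 / ν) := by
    refine intervalIntegral.integral_mono_ae_restrict hst.le (hgint s t hs0 (hs0.trans hst))
      ((hq.const_mul ν).neg.add intervalIntegrable_const) ?_
    rw [EventuallyLE, ae_restrict_iff' measurableSet_Icc]
    filter_upwards [hle] with x hx hxm
    exact hx (haT.trans (has.trans_le hxm.1))
  have hneg : IntervalIntegrable (fun x => -(ν * normV (u.toV x) ^ 2)) volume s t :=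
    (hq.const_mul ν).neg
  rw [← h1, intervalIntegral.integral_add hneg intervalIntegrable_const,
    intervalIntegral.integral_neg, intervalIntegral.integral_const_mul,
    intervalIntegral.integral_const, smul_eq_mul] at h2
  have h3 := hbound s hs has
  have h4 := sq_nonneg ‖u.toH t‖
  have h5 : (‖u.toH a‖ ^ 2 + F ^ 2 / ν / (ν / P ^ 2)) / ν + (t - s) * (F ^ 2 / ν ^ 2)
      = (‖u.toH a‖ ^ 2 + F ^ 2 / ν / (ν / P ^ 2) + (t - s) * (F ^ 2 / ν)) / ν := by
    field_simp
  rw [h5, le_div_iff₀ hν]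
  linarith

/-- The differential inequality for `|u - v|²`. -/
lemma two_mul_inner_riesz_dt_sub_le (u : WeakSolution Ω ν f u₀) (v : WeakSolution Ω ν g v₀)
    (hν : 0 < ν) {P : ℝ} (hP : ∀ v : V Ω, ‖V.field v‖ ≤ P * normV v) {c k ε T : ℝ}
    (hc : ∀ u w : V Ω, |trilinear w u w| ≤ c * ‖V.field w‖ * normV w * normV u)
    (hk : 0 < k) (hε : 0 ≤ ε) (hT : 0 < T)
    (hfg : ∀ᵐ t, T < t → normVDual (f t - g t) ≤ ENNReal.ofReal ε)
    (hR : ∀ᵐ t, T < t →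
      ‖V.field (u.toV t - v.toV t)‖ ≤ k * normV (u.toV t - v.toV t) + ε) :
    ∀ᵐ t, T < t → 2 * inner ℝ (riesz (u.dt t) - riesz (v.dt t)) (u.toV t - v.toV t)
      ≤ -((ν / (2 * k ^ 2) - 2 * c ^ 2 / ν * normV (u.toV t) ^ 2) * ‖u.toH t - v.toH t‖ ^ 2)
        + (2 / ν + ν / k ^ 2) * ε ^ 2 := by
  filter_upwards [hfg, hR, ae_restrict_Ioi_zero.1 u.equation, ae_restrict_Ioi_zero.1 v.equation,
    ae_restrict_Ioi_zero.1 u.toV_eq, ae_restrict_Ioi_zero.1 v.toV_eq] with t h1 h2 h3 h4 h5 h6 ht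
  have ht0 : 0 < t := hT.trans ht
  set w := u.toV t - v.toV t with hw
  have e1 := h3 ht0 w
  have e2 := h4 ht0 w
  have e3 := trilinear_sub_sub (u.toV t) (v.toV t)
  have e4 := dirichlet_sub_left (u.toV t) (v.toV t) w
  rw [← hw] at e3 e4
  rw [← normV_sq] at e4
  have e5 : ‖u.toH t - v.toH t‖ = ‖V.field w‖ := by
    have : V.field w = ((u.toH t - v.toH t : H Ω) : L2 Ω) := by
      rw [Submodule.coe_sub, ← h5 ht0, ← h6 ht0]
      exact map_sub V.fieldL _ _
    rw [this]; rfl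
  have e6 := le_of_abs_le (abs_apply_le_of_normVDual_le hP hε (h1 ht) w)
  have e7 := (abs_le.1 (hc (u.toV t) w)).1
  have e8 := h2 ht
  rw [inner_sub_left, inner_riesz, inner_riesz, e5]
  rw [sub_apply] at e6
  set X := normV w
  set Y := ‖V.field w‖
  set U := normV (u.toV t)
  have hX : 0 ≤ X := normV_nonneg w
  have hY : 0 ≤ Y := norm_nonneg _
  -- Of the dissipation `2νX²`, the forcing and the convection term take `νX²/2` each; `i3` converts
  -- the remaining `νX²` into damping of `Y²`.
  have i1 : 2 * (ε * X) ≤ ν / 2 * X ^ 2 + 2 / ν * ε ^ 2 := by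
    have : ν / 2 * X ^ 2 + 2 / ν * ε ^ 2 - 2 * (ε * X) = (ν * X - 2 * ε) ^ 2 / (2 * ν) := by
      field_simp; ring
    have h0 : 0 ≤ (ν * X - 2 * ε) ^ 2 / (2 * ν) := by positivity
    linarith
  have i2 : 2 * (c * Y * X * U) ≤ ν / 2 * X ^ 2 + 2 * c ^ 2 / ν * U ^ 2 * Y ^ 2 := by
    have : ν / 2 * X ^ 2 + 2 * c ^ 2 / ν * U ^ 2 * Y ^ 2 - 2 * (c * Y * X * U)
        = (ν * X - 2 * (c * Y * U)) ^ 2 / (2 * ν) := by field_simp; ring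
    have h0 : 0 ≤ (ν * X - 2 * (c * Y * U)) ^ 2 / (2 * ν) := by positivity
    linarith
  have i3 : ν / (2 * k ^ 2) * Y ^ 2 ≤ ν * X ^ 2 + ν / k ^ 2 * ε ^ 2 := by
    have h7 : Y ^ 2 ≤ 2 * k ^ 2 * X ^ 2 + 2 * ε ^ 2 := by
      have := pow_le_pow_left₀ hY e8 2
      nlinarith [sq_nonneg (k * X - ε)]
    have h8 : ν / (2 * k ^ 2) * Y ^ 2 ≤ ν / (2 * k ^ 2) * (2 * k ^ 2 * X ^ 2 + 2 * ε ^ 2) := by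
      gcongr
    have h9 : ν / (2 * k ^ 2) * (2 * k ^ 2 * X ^ 2 + 2 * ε ^ 2) = ν * X ^ 2 + ν / k ^ 2 * ε ^ 2 := by
      field_simp
    linarith
  have i4 : u.dt t w - v.dt t w = (f t w - g t w) - ν * X ^ 2 - trilinear w (u.toV t) w := by
    rw [e4, ← e3]
    linarith
  rw [i4]
  linarith

end WeakSolution

/-! ### Decay of the difference, first almost everywhere, then everywhere. -/

/-- An essential bound for a weakly continuous function holds everywhere. -/
lemma norm_le_of_ae_norm_le {X : Type*} [NormedAddCommGroup X] [InnerProductSpace ℝ X] {w : ℝ → X}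
    (hw : ∀ h : X, ContinuousOn (fun t => inner ℝ (w t) h) (Ici 0)) {T r : ℝ} (hT : 0 < T)
    (hr : 0 ≤ r) (h : ∀ᵐ t, T < t → ‖w t‖ ≤ r) {t : ℝ} (ht : T < t) : ‖w t‖ ≤ r := by
  have hc : ContinuousOn (fun s => (inner ℝ (w s) (w t) : ℝ)) (Ioi T) :=
    (hw (w t)).mono fun s hs => (hT.trans hs).le
  -- The inequality is encoded as an equality of continuous functions, which extends from almost
  -- every `s` to `s = t`.
  have heq : EqOn (fun s => min (inner ℝ (w s) (w t)) (r * ‖w t‖)) (fun s => inner ℝ (w s) (w t))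
      (Ioi T) := by
    refine Measure.eqOn_open_of_ae_eq (μ := volume) ?_ isOpen_Ioi
      (hc.inf continuousOn_const) hc
    rw [EventuallyEq, ae_restrict_iff' measurableSet_Ioi]
    filter_upwards [h] with s hs hsT
    refine min_eq_left ((real_inner_le_norm _ _).trans ?_)
    exact mul_le_mul_of_nonneg_right (hs hsT) (norm_nonneg _)
  have h1 : (inner ℝ (w t) (w t) : ℝ) ≤ r * ‖w t‖ := min_eq_left_iff.1 (heq ht)
  rw [real_inner_self_eq_norm_sq, sq] at h1
  rcases (norm_nonneg (w t)).eq_or_lt with h0 | h0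
  · rw [← h0]; exact hr
  · exact le_of_mul_le_mul_right h1 h0

namespace WeakSolution

variable {ν : ℝ} {f g : ℝ → VDual Ω} {u₀ v₀ : H Ω}

lemma exists_ae_norm_sub_sq_le (u : WeakSolution Ω ν f u₀) (v : WeakSolution Ω ν g v₀)
    (hν : 0 < ν) (hf : IsForcing f) (hg : IsForcing g) {P : ℝ} (hP0 : 0 < P)
    (hP : ∀ v : V Ω, ‖V.field v‖ ≤ P * normV v) {c k F T₀ : ℝ}
    (hc : ∀ u w : V Ω, |trilinear w u w| ≤ c * ‖V.field w‖ * normV w * normV u)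
    (hk : 0 < k) (hF : 0 ≤ F) (hT₀ : 0 < T₀)
    (hfF : ∀ᵐ t, T₀ < t → normVDual (f t) ≤ ENNReal.ofReal F)
    (hm : 0 < ν / (2 * k ^ 2) - 2 * c ^ 2 / ν * (F ^ 2 / ν ^ 2))
    (hfg : ∀ ε > 0, ∃ T, 0 < T ∧ ∀ᵐ t, T < t → normVDual (f t - g t) ≤ ENNReal.ofReal ε)
    (hR : ∀ ε > 0, ∃ T, 0 < T ∧ ∀ᵐ t, T < t →
      ‖V.field (u.toV t - v.toV t)‖ ≤ k * normV (u.toV t - v.toV t) + ε) {η : ℝ} (hη : 0 < η) :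
    ∃ T, 0 < T ∧ ∀ᵐ t, T < t → ‖u.toH t - v.toH t‖ ^ 2 ≤ η := by
  obtain ⟨G₁, hG₁, a₁, B, ha₁, hB, hmean⟩ := u.exists_integral_normV_sq_le hν hf hP0 hP hF hT₀ hfF
  obtain ⟨G₂, hG₂, hE⟩ := u.exists_energy_equality_sub v hν hf hg
  set m := ν / (2 * k ^ 2) - 2 * c ^ 2 / ν * (F ^ 2 / ν ^ 2)
  set M := 2 * c ^ 2 / ν * B
  -- The Grönwall bound tends to `K ε²`, and `ε` is chosen to make this `η / 2`. No circularity
  -- arises: `B`, hence `M` and `K`, is fixed before `ε`.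
  set K := Real.exp M * (2 / ν + ν / k ^ 2) / m
  have hK : 0 < K := by positivity
  set ε := √(η / (2 * K))
  have hε : 0 < ε := Real.sqrt_pos.2 (by positivity)
  have hε2 : K * ε ^ 2 = η / 2 := by
    rw [Real.sq_sqrt (by positivity)]
    field_simp
  obtain ⟨T₂, hT₂, hfg⟩ := hfg ε hε
  obtain ⟨T₃, hT₃, hR⟩ := hR ε hε
  set T := max T₂ T₃
  have hT : 0 < T := hT₂.trans_le (le_max_left _ _)
  have hle := u.two_mul_inner_riesz_dt_sub_le v hν hP hc hk hε.le hT
    (by filter_upwards [hfg] with t ht h using ht ((le_max_left _ _).trans_lt h))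
    (by filter_upwards [hR] with t ht h using ht ((le_max_right _ _).trans_lt h))
  have hG : ∀ᵐ t : ℝ, 0 < t → t ∈ G₁ ∩ G₂ := by
    filter_upwards [hG₁, hG₂] with t h1 h2 h using ⟨h1 h, h2 h⟩
  obtain ⟨a, haG, haT⟩ := exists_gt_mem_of_ae hG (T := max T a₁) (hT.le.trans (le_max_left _ _))
  have haT' : T < a := (le_max_left _ _).trans_lt haT
  have haa : a₁ < a := (le_max_right _ _).trans_lt haT
  have ha0 : 0 < a := hT.trans haT'
  set y : ℝ → ℝ := fun t => ‖u.toH t - v.toH t‖ ^ 2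
  set δ := (2 / ν + ν / k ^ 2) * ε ^ 2
  set α : ℝ → ℝ := fun t => ν / (2 * k ^ 2) - 2 * c ^ 2 / ν * normV (u.toV t) ^ 2
  have hα : ∀ s t, 0 < s → 0 < t → IntervalIntegrable α volume s t := fun s t hs ht =>
    intervalIntegrable_const.sub ((intervalIntegrable_normV_sq u.memL2 hs ht).const_mul _)
  have hgint : ∀ s t, 0 < s → 0 < t → IntervalIntegrable
      (fun x => 2 * inner ℝ (riesz (u.dt x) - riesz (v.dt x)) (u.toV x - v.toV x)) volume s t :=
    fun s t hs ht => (intervalIntegrable_inner (W := fun x => u.toV x - v.toV x)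
      (D := fun x => riesz (u.dt x) - riesz (v.dt x))
      (fun T hT => (u.memL2 T hT).sub (v.memL2 T hT))
      (fun T hT => (u.memLp_riesz_dt hν hf T hT).sub (v.memLp_riesz_dt hν hg T hT))
      hs ht).const_mul 2
  have hmean' : ∀ s ∈ G₁, ∀ t ∈ G₁, a₁ < s → s ≤ t → m * (t - s) - M ≤ ∫ x in s..t, α x := by
    intro s hs t ht has hst
    have hs0 : 0 < s := (hT₀.trans ha₁).trans has
    have ht0 : 0 < t := hs0.trans_le hst
    have h1 : ∫ x in s..t, normV (u.toV x) ^ 2 ≤ B + (t - s) * (F ^ 2 / ν ^ 2) := by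
      rcases hst.eq_or_lt with rfl | hst
      · simpa using hB
      · exact hmean s hs t ht has hst
    rw [intervalIntegral.integral_sub intervalIntegrable_const
      ((intervalIntegrable_normV_sq u.memL2 hs0 ht0).const_mul _),
      intervalIntegral.integral_const, intervalIntegral.integral_const_mul, smul_eq_mul]
    have h2 : 2 * c ^ 2 / ν * ∫ x in s..t, normV (u.toV x) ^ 2
        ≤ 2 * c ^ 2 / ν * (B + (t - s) * (F ^ 2 / ν ^ 2)) := by gcongr
    simp only [m, M]
    linarith
  have hgr : ∀ t ∈ G₁ ∩ G₂, a < t →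
      y t ≤ Real.exp M * (y a * Real.exp (-(m * (t - a))) + δ / m) := by
    intro t ht hat
    refine gronwall_of_mean hat.le hm (by positivity) (by positivity)
      (hgint a t ha0 (ha0.trans hat)) (hα a t ha0 (ha0.trans hat)) ?_ ?_ ?_ ?_ ?_
    · filter_upwards [hG₂] with s hs hsm
      linarith [hE a haG.2 s (hs (ha0.trans hsm.1)) ha0 hsm.1]
    · linarith [hE a haG.2 t ht.2 ha0 hat]
    · filter_upwards [hle] with s hs hsm
      exact hs (haT'.trans hsm.1)
    · filter_upwards [hG₁] with s hs hsm
      exact hmean' s (hs (ha0.trans hsm.1)) t ht.1 (haa.trans hsm.1) hsm.2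
    · exact hmean' a haG.1 t ht.1 haa hat.le
  have hlim : Tendsto (fun t => Real.exp M * (y a * Real.exp (-(m * (t - a))) + δ / m)) atTop
      (𝓝 (Real.exp M * (y a * 0 + δ / m))) := by
    refine ((Tendsto.const_mul _ ?_).add_const _).const_mul _
    refine Real.tendsto_exp_neg_atTop_nhds_zero.comp ?_
    exact (tendsto_atTop_add_const_right _ (-a) tendsto_id).const_mul_atTop hm
  have hlt : Real.exp M * (y a * 0 + δ / m) < η := by
    have : Real.exp M * (y a * 0 + δ / m) = K * ε ^ 2 := by
      simp only [K, δ]; ring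
    rw [this, hε2]
    exact half_lt_self hη
  obtain ⟨T', hT'⟩ := eventually_atTop.1 (hlim.eventually (gt_mem_nhds hlt))
  refine ⟨max a T', ha0.trans_le (le_max_left _ _), ?_⟩
  filter_upwards [hG] with t ht htT
  have hat : a < t := (le_max_left _ _).trans_lt htT
  exact (hgr t (ht (ha0.trans hat)) hat).trans (hT' t ((le_max_right _ _).trans htT.le)).le

lemma tendsto_norm_sub_of_forall_ae (u : WeakSolution Ω ν f u₀) (v : WeakSolution Ω ν g v₀)
    (h : ∀ η > 0, ∃ T, 0 < T ∧ ∀ᵐ t, T < t → ‖u.toH t - v.toH t‖ ^ 2 ≤ η) :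
    Tendsto (fun t => ‖u.toH t - v.toH t‖) atTop (𝓝 0) := by
  rw [Metric.tendsto_atTop]
  intro ε hε
  obtain ⟨T, hT, hae⟩ := h ((ε / 2) ^ 2) (by positivity)
  refine ⟨T + 1, fun t ht => ?_⟩
  have h1 : ‖u.toH t - v.toH t‖ ≤ ε / 2 := by
    refine norm_le_of_ae_norm_le (w := fun t => u.toH t - v.toH t) (fun h => ?_) hT (by positivity)
      ?_ (by linarith : T < t)
    · simp only [inner_sub_left]
      exact (u.weaklyContinuous h).sub (v.weaklyContinuous h)
    · filter_upwards [hae] with s hs hsT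
      exact abs_le_of_sq_le_sq' (hs hsT) (by positivity) |>.2
  rw [Real.dist_eq, sub_zero, abs_of_nonneg (norm_nonneg _)]
  linarith

end WeakSolution

/-! ### The condition on `N` and the conclusion. -/

lemma exists_real_bound_of_lt {ν γ K : ℝ} (hν : 0 < ν) (hγ : 0 < γ) (hK : 0 < K) {N : ℕ}
    {F : ℝ≥0∞} (h : ENNReal.ofReal (K ^ (1 / γ)) *
      (ENNReal.ofReal (1 / ν ^ 2) * F) ^ (1 / γ) < (N : ℝ≥0∞)) :
    ∃ F' : ℝ, 0 ≤ F' ∧ F < ENNReal.ofReal F' ∧ K * (N : ℝ) ^ (-γ) * F' < ν ^ 2 := by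
  have hN : 0 < N := by
    rcases Nat.eq_zero_or_pos N with rfl | h'
    · simp at h
    · exact h'
  have hC : 0 < K ^ (1 / γ) := by positivity
  have hF : F ≠ ⊤ := by
    rintro rfl
    rw [ENNReal.mul_top (by simp; positivity), ENNReal.top_rpow_of_pos (by positivity),
      ENNReal.mul_top (by simpa using hC)] at h
    exact not_top_lt h
  lift F to ℝ≥0 using hF
  have h1 : K ^ (1 / γ) * (1 / ν ^ 2 * (F : ℝ)) ^ (1 / γ) < N := by
    rw [← ENNReal.ofReal_coe_nnreal, ← ENNReal.ofReal_mul (by positivity),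
      ENNReal.ofReal_rpow_of_nonneg (by positivity) (by positivity),
      ← ENNReal.ofReal_mul hC.le, ← ENNReal.ofReal_natCast,
      ENNReal.ofReal_lt_ofReal_iff (by positivity)] at h
    exact h
  have h2 : K * (1 / ν ^ 2 * (F : ℝ)) < (N : ℝ) ^ γ := by
    rw [← Real.mul_rpow hK.le (by positivity)] at h1
    have := Real.rpow_lt_rpow (by positivity) h1 hγ
    rwa [← Real.rpow_mul (by positivity), one_div_mul_cancel hγ.ne', Real.rpow_one] at this
  have hNγ : 0 < (N : ℝ) ^ γ := by positivity
  have h3 : K * (N : ℝ) ^ (-γ) * F < ν ^ 2 := by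
    rw [Real.rpow_neg (by positivity)]
    have h4 : K * (1 / ν ^ 2 * (F : ℝ)) = K * F / ν ^ 2 := by ring
    rw [h4, div_lt_iff₀ (by positivity)] at h2
    have h5 : K * ((N : ℝ) ^ γ)⁻¹ * F = K * F / (N : ℝ) ^ γ := by ring
    rw [h5, div_lt_iff₀ hNγ]
    linarith
  set q := K * (N : ℝ) ^ (-γ)
  have hq : 0 < q := by positivity
  -- The midpoint between `F` and the threshold `ν² / q`: strictly above the upper limit, hence
  -- eventually a bound for the forcing, and still admissible.
  refine ⟨(F + ν ^ 2 / q) / 2, by positivity, ?_, ?_⟩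
  · rw [← ENNReal.ofReal_coe_nnreal, ENNReal.ofReal_lt_ofReal_iff (by positivity)]
    have : (F : ℝ) < ν ^ 2 / q := by rw [lt_div_iff₀ hq]; linarith
    linarith
  · have : q * ((F + ν ^ 2 / q) / 2) = (q * F + ν ^ 2) / 2 := by field_simp
    rw [this]
    linarith

end NavierStokes

end

open NavierStokes
theorem theorem4p1 (Ω : Set Plane) (hΩ_open : IsOpen Ω) (hΩ_conn : IsConnected Ω)
    (hΩ_bdd : Bornology.IsBounded Ω) (hΩ_lip : HasLipschitzBoundary Ω)
    (C₁ γ : ℝ) (hC₁ : 0 < C₁) (hγ : 0 < γ) :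
    ∃ C : ℝ, 0 < C ∧
      ∀ (ν : ℝ) (_ : 0 < ν)
        (f g : ℝ → VDual Ω) (_ : IsForcing f) (_ : IsForcing g)
        (_ : Tendsto (fun t => normVDual (f t - g t)) aeTop (𝓝 0))
        (u₀ v₀ : H Ω) (u : WeakSolution Ω ν f u₀) (v : WeakSolution Ω ν g v₀)
        (N : ℕ) (VN : Submodule ℝ (L2 Ω)) (_ : FiniteDimensional ℝ VN)
        (_ : Module.finrank ℝ VN = N)
        (R : V Ω →ₗ[ℝ] VN)
        (_ : Tendsto (fun t => ‖R (u.toV t - v.toV t)‖) aeTop (𝓝 0))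
        (_ : ∀ w : V Ω, ‖V.field w - (R w : L2 Ω)‖ ≤ C₁ * (N : ℝ) ^ (-γ) * normH1 w)
        (_ : ENNReal.ofReal C *
            (ENNReal.ofReal (1 / ν ^ 2) * limsup (fun t => normVDual (f t)) aeTop) ^ (1 / γ)
              < (N : ℝ≥0∞)),
        Tendsto (fun t => ‖u.toH t - v.toH t‖) atTop (𝓝 0) := by
  obtain ⟨P₀, hP₀, hP₀'⟩ := exists_poincare hΩ_bdd
  have hP : ∀ v : V Ω, ‖V.field v‖ ≤ (P₀ + 1) * normV v := fun v =>
    (hP₀' v).trans (by nlinarith [normV_nonneg v])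
  obtain ⟨Q, hQ, hQ'⟩ := exists_normH1_le hP
  -- The added `1`, here as in `P₀ + 1`, only ensures positivity.
  set c : ℝ := 8 * gnsConst + 1
  have hc0 : 0 < c := by positivity
  have hc : ∀ u w : V Ω, |trilinear w u w| ≤ c * ‖V.field w‖ * normV w * normV u := fun u w => by
    refine (abs_trilinear_self_le u w).trans ?_
    have := mul_nonneg (mul_nonneg (norm_nonneg (V.field w)) (normV_nonneg w)) (normV_nonneg u)
    simp only [c]
    linarith
  have hK : 0 < 2 * c * C₁ * Q := by positivity
  refine ⟨(2 * c * C₁ * Q) ^ (1 / γ), by positivity, ?_⟩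
  intro ν hν f g hf hg hfg u₀ v₀ u v N VN _ hVN R hRlim hRle hN
  obtain ⟨F, hF0, hF, hFν⟩ := exists_real_bound_of_lt hν hγ hK hN
  have hNpos : 0 < N := by
    rcases Nat.eq_zero_or_pos N with rfl | h'
    · simp at hN
    · exact h'
  set k : ℝ := C₁ * (N : ℝ) ^ (-γ) * Q
  have hk : 0 < k := by positivity
  obtain ⟨T₀, hT₀, hfF⟩ := eventually_aeTop (eventually_lt_of_limsup_lt hF)
  refine u.tendsto_norm_sub_of_forall_ae v fun η hη => ?_
  refine u.exists_ae_norm_sub_sq_le v hν hf hg (by positivity) hP hc hk hF0 hT₀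
    (by filter_upwards [hfF] with t ht h using (ht h).le) ?_ ?_ ?_ hη
  -- Positivity of the mean damping is exactly `2ckF < ν²`; this dictates the constant `(2 c C₁ Q) ^
  -- (1/γ)`.
  · have h1 : 2 * c * k * F < ν ^ 2 := by
      refine lt_of_eq_of_lt ?_ hFν
      simp only [k]; ring
    have h2 : (2 * c * k * F) ^ 2 < (ν ^ 2) ^ 2 := by gcongr
    have h3 : ν / (2 * k ^ 2) - 2 * c ^ 2 / ν * (F ^ 2 / ν ^ 2)
        = ((ν ^ 2) ^ 2 - (2 * c * k * F) ^ 2) / (2 * k ^ 2 * ν ^ 3) := by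
      field_simp
    rw [h3]
    exact div_pos (by linarith) (by positivity)
  · intro ε hε
    exact eventually_aeTop (hfg.eventually_le_const (by simpa using hε))
  · intro ε hε
    obtain ⟨T, hT, h⟩ := eventually_aeTop (hRlim.eventually_le_const hε)
    refine ⟨T, hT, ?_⟩
    filter_upwards [h] with t ht htT
    set w := u.toV t - v.toV t
    have h1 : ‖V.field w‖ ≤ ‖V.field w - (R w : L2 Ω)‖ + ‖(R w : L2 Ω)‖ := by
      simpa using norm_add_le (V.field w - (R w : L2 Ω)) (R w : L2 Ω)
    have h2 : ‖(R w : L2 Ω)‖ ≤ ε := ht htT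
    have h3 : C₁ * (N : ℝ) ^ (-γ) * normH1 w ≤ C₁ * (N : ℝ) ^ (-γ) * (Q * normV w) := by
      gcongr
      exact hQ' w
    have h4 := hRle w
    have h5 : C₁ * (N : ℝ) ^ (-γ) * (Q * normV w) = k * normV w := by simp only [k]; ring
    linarith
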